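/- **Setting.** Let $\mathcal K$ be an essentially small triangulated category with suspension $T$, equipped with a symmetric monoidal structure $\otimes$ with unit $\mathbb 1$ such that the functors $a\otimes-$ and $-\otimes b$ are exact for all objects $a,b$, and such that the two canonical identifications of $T(a)\otimes T(b)$ with $T^2(a\otimes b)$ differ by the sign $-1$. Assume that $\mathcal K$ is idempotent complete and *strongly closed*: there is a bi-exact internal hom functor $\underline{\hom}:\mathcal K^{\mathrm{op}}\times\mathcal K\to\mathcal K$ with natural isomorphisms $\mathrm{Hom}(a\otimes b,c)\cong \mathrm{Hom}(a,\underline{\hom}(b,c))$, and for all $a,b$ the natural morphism $\underline{\hom}(a,\mathbb 1)\otimes b\to\underline{\hom}(a,b)$ is an isomorphism. Let $\mathrm{Spc}(\mathcal K)$ be the set of prime ideals of $\mathcal K$, i.e. of the proper full triangulated subcategories $\mathcal P\subsetneq\mathcal K$ which are thick ($a\oplus b\in\mathcal P$ implies $a,b\in\mathcal P$), $\otimes$-ideals ($a\in\mathcal P$ implies $a\otimes b\in\mathcal P$ for all $b$) and prime ($a\otimes b\in\mathcal P$ implies $a\in\mathcal P$ or $b\in\mathcal P$). Put $\mathrm{supp}(a)=\{\mathcal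 P : a\notin\mathcal P\}$ and give $\mathrm{Spc}(\mathcal K)$ the topology with basis of open sets the complements of the $\mathrm{supp}(a)$, $a\in\mathcal K$. For a quasi-compact open $U\subseteq\mathrm{Spc}(\mathcal K)$ with complement $Z$, let $\mathcal K_Z$ be the full subcategory of the objects $a$ with $\mathrm{supp}(a)\subseteq Z$, and let $\mathcal K(U)$ be the idempotent completion of the Verdier quotient $\mathcal K/\mathcal K_Z$. Let $\rho_U:\mathcal K\to\mathcal K(U)$ and, for $U\subseteq V$, $\rho_{V,U}:\mathcal K(V)\to\mathcal K(U)$ be the canonical restriction functors, so that $\rho_{V,U}\circ\rho_V\cong\rho_U$ canonically. **Theorem (Gluing of two objects).** Let $\mathrm{Spc}(\mathcal K)=U_1\cup U_2$ with $U_1,U_2$ quasi-compact open. Write $\rho_i=\rho_{U_i}$, $\rho_{12}=\rho_{U_1,U_1\cap U_2}$ and $\rho_{21}=\rho_{U_2,U_1\cap U_2}$. Let $a_1\in\mathcal K(U_1)$ and $a_2\in\mathcal K(U_2)$ be objects and let $\sigma:\rho_{12}(a_1)\xrightarrow{\sim}\rho_{21}(a_2)$ be an isomorphism in $\mathcal K(U_1\cap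 U_2)$. Then there exists a gluing $(a,f_1,f_2)$, that is, an object $a\in\mathcal K$ with isomorphisms $f_i:\rho_i(a)\xrightarrow{\sim}a_i$ in $\mathcal K(U_i)$ for $i=1,2$ such that $\sigma\circ\rho_{12}(f_1)=\rho_{21}(f_2)$ in $\mathcal K(U_1\cap U_2)$, where $\rho_{12}\rho_1(a)$ and $\rho_{21}\rho_2(a)$ are identified canonically with $\rho_{U_1\cap U_2}(a)$. Moreover, any two gluings $(a,f_1,f_2)$ and $(a',f_1',f_2')$ are isomorphic: there exists an isomorphism $f:a\xrightarrow{\sim}a'$ in $\mathcal K$, not necessarily unique, such that $f_i'\circ\rho_i(f)=f_i$ for $i=1,2$. -/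

import Mathlib

open CategoryTheory Category Limits MonoidalCategory Pretriangulated
open CategoryTheory.Pretriangulated.Opposite

universe v u v₁ v₂ u₁ u₂

namespace TTGeometry

/-- A functor between triangulated categories is exact if it can be equipped with natural
isomorphisms of commutation with the suspensions for which it sends distinguished triangles to
distinguished triangles. -/
def IsExactFunctor {C : Type u₁} {D : Type u₂} [Category.{v₁} C] [Category.{v₂} D]
    [HasZeroObject C] [HasZeroObject D] [HasShift C ℤ] [HasShift D ℤ]
    [Preadditive C] [Preadditive D]
    [∀ n : ℤ, (shiftFunctor C n).Additive] [∀ n : ℤ, (shiftFunctor D n).Additive]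
    [Pretriangulated C] [Pretriangulated D] (F : C ⥤ D) : Prop :=
  ∃ _ : F.CommShift ℤ, F.IsTriangulated

section

variable (K : Type u) [Category.{v} K] [HasZeroObject K] [HasShift K ℤ] [Preadditive K]
  [∀ n : ℤ, (shiftFunctor K n).Additive] [Pretriangulated K] [MonoidalCategory K]

/-- Compatibility of the tensor product with the triangulation: the functors `a ⊗ -` and `- ⊗ b`
are exact, and the two identifications of `T a ⊗ T b` with `T² (a ⊗ b)` differ by the sign `-1`
(this is the case `m = n = 1` of the sign rule `(-1) ^ (m * n)` in `Functor.CommShift₂Int`). -/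
class TensorTriangulated where
  [commShift : (curriedTensor K).CommShift₂Int]
  exact_left (a : K) : ((curriedTensor K).obj a).IsTriangulated
  exact_right (b : K) : ((curriedTensor K).flip.obj b).IsTriangulated

attribute [reducible, instance] TensorTriangulated.commShift
attribute [instance] TensorTriangulated.exact_left TensorTriangulated.exact_right

variable {K} in
/-- The dual `D a = hom(a, 1)`. -/
noncomputable abbrev dualObj [MonoidalClosed K] (a : K) : K := (ihom a).obj (𝟙_ K)

variable {K} in
/-- The natural morphism `D a ⊗ b ⟶ hom(a, b)`: the adjoint of
`a ⊗ (D a ⊗ b) ≅ (a ⊗ D a) ⊗ b ⟶ 1 ⊗ b ≅ b`. -/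
noncomputable def dualTensorHom [MonoidalClosed K] (a b : K) :
    dualObj a ⊗ b ⟶ (ihom a).obj b :=
  MonoidalClosed.curry
    ((α_ a (dualObj a) b).inv ≫ (ihom.ev a).app (𝟙_ K) ▷ b ≫ (λ_ b).hom)

/-- Strongly closed: the internal hom is exact in each variable and every object is strongly
dualizable. -/
class StronglyClosed [MonoidalClosed K] : Prop where
  exact_hom_right (a : Kᵒᵖ) :
    IsExactFunctor ((MonoidalClosed.internalHom : Kᵒᵖ ⥤ K ⥤ K).obj a)
  exact_hom_left (b : K) :
    IsExactFunctor ((MonoidalClosed.internalHom : Kᵒᵖ ⥤ K ⥤ K).flip.obj b)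
  strongly_dualizable (a b : K) : IsIso (dualTensorHom a b)

variable {K} in
/-- Thick tensor ideals (given by the property of objects that defines the full subcategory). -/
structure IsThickTensorIdeal (J : ObjectProperty K) : Prop where
  isTriangulated : J.IsTriangulated
  closedUnderIso : J.IsClosedUnderIsomorphisms
  thick (a b : K) : J (a ⊞ b) → J a ∧ J b
  ideal (a b : K) : J a → J (a ⊗ b)

/-- The spectrum: the set of prime ideals, i.e. proper thick tensor ideals which are prime. -/
@[ext]
structure Spc where
  carrier : ObjectProperty K
  isThickTensorIdeal : IsThickTensorIdeal carrier
  proper : ∃ a : K, ¬ carrier a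
  prime (a b : K) : carrier (a ⊗ b) → carrier a ∨ carrier b

variable {K}

/-- The support of an object: the primes which do not contain it. -/
def supp (a : K) : Set (Spc K) := {P | ¬ P.carrier a}

/-- The Zariski topology: the complements of the supports form a basis of open sets. -/
instance : TopologicalSpace (Spc K) :=
  TopologicalSpace.generateFrom (Set.range fun a : K => (supp a)ᶜ)

/-- The full subcategory of the objects supported on `Y`. -/
def supportedOn (Y : Set (Spc K)) : ObjectProperty K := fun a => supp a ⊆ Y

/-- The morphisms which have a cone supported outside of `U`. -/
abbrev isosOn (U : Set (Spc K)) : MorphismProperty K := (supportedOn Uᶜ).trW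

/-- The Verdier quotient of `K` by the objects supported outside of `U`, obtained by inverting the
morphisms which have a cone supported outside of `U`. -/
abbrev LOn (U : Set (Spc K)) := (isosOn U).Localization

/-- The category `K(U)`: the idempotent completion of the Verdier quotient. -/
abbrev KOn (U : Set (Spc K)) := Idempotents.Karoubi (LOn U)

/-- The restriction functor `K ⥤ K(U)`. -/
noncomputable def restr (U : Set (Spc K)) : K ⥤ KOn U := (isosOn U).Q ⋙ Idempotents.toKaroubi (LOn U)

lemma isosOn_antitone {U V : Set (Spc K)} (h : U ⊆ V) : isosOn V ≤ isosOn U :=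
  ObjectProperty.trW_monotone fun _ ha => Set.Subset.trans ha (Set.compl_subset_compl.2 h)

lemma isosOn_isInvertedBy {U V : Set (Spc K)} (h : U ⊆ V) :
    (isosOn V).IsInvertedBy (isosOn U).Q :=
  fun _ _ f hf => (isosOn U).Q_inverts f (isosOn_antitone h f hf)

/-- The localization functor between Verdier quotients, for `U ⊆ V`: the unique functor which is
compatible with the localization functors from `K`. -/
noncomputable def restrL {U V : Set (Spc K)} (h : U ⊆ V) : LOn V ⥤ LOn U :=
  Localization.Construction.lift (isosOn U).Q (isosOn_isInvertedBy h)

/-- The restriction functor `K(V) ⥤ K(U)` for `U ⊆ V`, induced on idempotent completions. -/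
noncomputable def restrK {U V : Set (Spc K)} (h : U ⊆ V) : KOn V ⥤ KOn U :=
  (Idempotents.functorExtension₂ (LOn V) (LOn U)).obj (restrL h)

lemma restrL_map_Q {U V : Set (Spc K)} (h : U ⊆ V) {a b : K} (f : a ⟶ b) :
    (restrL h).map ((isosOn V).Q.map f) = (isosOn U).Q.map f :=
  (Functor.congr_hom
    (Localization.Construction.fac (isosOn U).Q (isosOn_isInvertedBy h)) f).trans
    ((id_comp _).trans (comp_id _))

lemma restrL_map_id {U V : Set (Spc K)} (h : U ⊆ V) (a : K) :
    (restrL h).map (𝟙 ((isosOn V).Q.obj a)) = 𝟙 ((isosOn U).Q.obj a) :=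
  (restrL h).map_id _

/-- Restricting from `K` to `K(V)` and then to `K(U)` is restricting to `K(U)`: the canonical
isomorphism, given by identities of the objects of the Verdier quotient. -/
noncomputable def restrCompIso {U V : Set (Spc K)} (h : U ⊆ V) :
    restr V ⋙ restrK h ≅ restr U :=
  NatIso.ofComponents
    (fun a =>
      { hom :=
          { f := 𝟙 ((isosOn U).Q.obj a)
            comm := by
              refine Eq.trans ?_ (id_comp _)
              exact congrArg₂ _ (restrL_map_id h a) (comp_id _) }
        inv :=
          { f := 𝟙 ((isosOn U).Q.obj a)
            comm := by
              refine Eq.trans ?_ (id_comp _)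
              exact congrArg₂ _ rfl ((id_comp _).trans (restrL_map_id h a)) }
        hom_inv_id := Idempotents.Karoubi.Hom.ext
          ((id_comp _).trans (restrL_map_id h a).symm)
        inv_hom_id := Idempotents.Karoubi.Hom.ext (id_comp _) })
    (fun f => Idempotents.Karoubi.Hom.ext
      ((comp_id _).trans ((restrL_map_Q h f).trans (id_comp _).symm)))

/-- A gluing of `a₁` and `a₂` along an isomorphism `σ` over `U₁ ∩ U₂`: an object `a` of `K` with
isomorphisms `fᵢ : a ≅ aᵢ` over `Uᵢ` such that `σ ∘ f₁ = f₂` over `U₁ ∩ U₂`. -/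
structure Gluing {U₁ U₂ : Set (Spc K)} (a₁ : KOn U₁) (a₂ : KOn U₂)
    (σ : (restrK (Set.inter_subset_left : U₁ ∩ U₂ ⊆ U₁)).obj a₁ ≅
      (restrK (Set.inter_subset_right : U₁ ∩ U₂ ⊆ U₂)).obj a₂) where
  obj : K
  iso₁ : (restr U₁).obj obj ≅ a₁
  iso₂ : (restr U₂).obj obj ≅ a₂
  comm : (restrCompIso Set.inter_subset_left).inv.app obj ≫
      (restrK (Set.inter_subset_left : U₁ ∩ U₂ ⊆ U₁)).map iso₁.hom ≫ σ.hom =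
    (restrCompIso Set.inter_subset_right).inv.app obj ≫
      (restrK (Set.inter_subset_right : U₁ ∩ U₂ ⊆ U₂)).map iso₂.hom

/-- An isomorphism of gluings: an isomorphism in `K` which is compatible with the given
isomorphisms over `U₁` and over `U₂`. -/
structure GluingIso {U₁ U₂ : Set (Spc K)} {a₁ : KOn U₁} {a₂ : KOn U₂}
    {σ : (restrK (Set.inter_subset_left : U₁ ∩ U₂ ⊆ U₁)).obj a₁ ≅
      (restrK (Set.inter_subset_right : U₁ ∩ U₂ ⊆ U₂)).obj a₂}
    (g g' : Gluing a₁ a₂ σ) where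
  iso : g.obj ≅ g'.obj
  comm₁ : (restr U₁).map iso.hom ≫ g'.iso₁.hom = g.iso₁.hom
  comm₂ : (restr U₂).map iso.hom ≫ g'.iso₂.hom = g.iso₂.hom

end

end TTGeometry

open TTGeometry

/-!
Let `Z₁` and `Z₂` be the (disjoint) complements of `U₁` and `U₂`, let `J₁` and `J₂` be the
subcategories of the objects supported on `Z₁` and on `Z₂`, and let `J` be the subcategory of the
objects supported on `Z₁ ∪ Z₂`. The theorem follows from the fact that `J` is the orthogonal sum
of `J₁` and `J₂` (`isOrthogonalSum_supportedOn`).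

As every object is strongly dualizable, `a` is a direct summand of `(a ⊗ D a) ⊗ a`. Hence thick
tensor ideals are radical, a thick tensor ideal is the intersection of the primes containing it
(`exists_prime`, by Zorn's lemma), and there are no nonzero morphisms between objects with disjoint
supports (`hom_eq_zero_of_disjoint_supp`). In particular `J₁` and `J₂` are orthogonal to each
other. Orthogonality and idempotent completeness imply that the sums of an object of `J₁` and an
object of `J₂` form a thick tensor ideal. As `Z₁` and `Z₂` are supports of objects, which is where
quasi-compactness is used, a prime containing this ideal lies in `U₁ ∩ U₂`, so that the ideal
is `J`.

The remainder of the argument takes place in an idempotent complete triangulated category `C` with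
an orthogonal sum `J` of thick subcategories `J₁` and `J₂`.
* Two morphisms in `C/J₁` and `C/J₂` which agree in `C/J` lift to `C`
  (`IsOrthogonalSum.exists_lift`). They are represented by fractions, which can be compared on the
  homotopy pullback of their denominators. The difference factors through an object of `J`, and
  the two components of this factorization can be absorbed in the numerators. Since a morphism of
  `C` is invertible if it is so in both quotients, this implies that gluings are isomorphic.
* Two objects of `C` which are isomorphic in `C/J` can be glued (`IsOrthogonalSum.exists_glue`).
  Both legs of a roof are factored into a morphism with cone in `J₁` and a morphism with cone in
  `J₂`, and the glued object is a homotopy pushout.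
* For objects of the idempotent completions, there is an obstruction to being in the Verdier
  quotient, which vanishes for the sum of an object and its suspension: if the object is the image
  of the idempotent `e`, then the sum is the cone of `1 - e` (`exists_image_sum_shift_image`). These
  sums are glued to an object `d` of `C`. The projections to the first summands lift to an
  idempotent of `d`, because the kernel of `End d → End_{C/J₁} d × End_{C/J₂} d` has square zero
  (`IsOrthogonalSum.exists_idempotent_lift`). The image of this idempotent is the gluing.
-/

namespace TTGeometry

section

variable {C : Type u} [Category.{v} C]

/-! ### Comparison of localizations -/

section

variable {W W' : MorphismProperty C}

/-- For `W ≤ W'`, the canonical functor `C[W⁻¹] ⥤ C[W'⁻¹]`. -/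
noncomputable def locMap (h : W ≤ W') : W.Localization ⥤ W'.Localization :=
  Localization.Construction.lift W'.Q (fun _ _ f hf => W'.Q_inverts f (h f hf))

/-- The action of `locMap` on the morphisms between objects coming from `C`. Since the two
localizations have the objects of `C` as objects, no transport is needed. -/
noncomputable def resMap (h : W ≤ W') {x y : C} (φ : W.Q.obj x ⟶ W.Q.obj y) :
    W'.Q.obj x ⟶ W'.Q.obj y :=
  (locMap h).map φ

lemma locMap_fac (h : W ≤ W') : W.Q ⋙ locMap h = W'.Q :=
  Localization.Construction.fac _ _

lemma resMap_map (h : W ≤ W') {x y : C} (f : x ⟶ y) :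
    resMap h (W.Q.map f) = W'.Q.map f :=
  (Functor.congr_hom (locMap_fac h) f).trans ((id_comp _).trans (comp_id _))

@[simp]
lemma resMap_id (h : W ≤ W') (x : C) : resMap h (𝟙 (W.Q.obj x)) = 𝟙 _ :=
  (locMap h).map_id _

lemma resMap_comp (h : W ≤ W') {x y z : C} (φ : W.Q.obj x ⟶ W.Q.obj y)
    (ψ : W.Q.obj y ⟶ W.Q.obj z) : resMap h (φ ≫ ψ) = resMap h φ ≫ resMap h ψ :=
  (locMap h).map_comp _ _

instance (h : W ≤ W') {x y : C} (φ : W.Q.obj x ⟶ W.Q.obj y) [IsIso φ] :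
    IsIso (resMap h φ) :=
  inferInstanceAs (IsIso ((locMap h).map φ))

lemma resMap_add [Preadditive C] [W.HasLeftCalculusOfFractions] [HasFiniteProducts C]
    [W'.HasLeftCalculusOfFractions] (h : W ≤ W') {x y : C} (φ ψ : W.Q.obj x ⟶ W.Q.obj y) :
    resMap h (φ + ψ) = resMap h φ + resMap h ψ := by
  have : (locMap h).Additive := by
    rw [Localization.functor_additive_iff W.Q W, locMap_fac]
    infer_instance
  exact (locMap h).map_add

end

section

variable [HasShift C ℤ]

/-- The suspension of a morphism of the localization, as a morphism between the images of the
suspensions. -/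
noncomputable def shiftMap {W : MorphismProperty C} [W.IsCompatibleWithShift ℤ] {x y : C}
    (φ : W.Q.obj x ⟶ W.Q.obj y) : W.Q.obj (x⟦(1 : ℤ)⟧) ⟶ W.Q.obj (y⟦(1 : ℤ)⟧) :=
  (W.Q.commShiftIso (1 : ℤ)).hom.app x ≫ φ⟦(1 : ℤ)⟧' ≫ (W.Q.commShiftIso (1 : ℤ)).inv.app y

lemma shiftMap_comp {W : MorphismProperty C} [W.IsCompatibleWithShift ℤ] {x y z : C}
    (φ : W.Q.obj x ⟶ W.Q.obj y) (ψ : W.Q.obj y ⟶ W.Q.obj z) :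
    shiftMap (φ ≫ ψ) = shiftMap φ ≫ shiftMap ψ := by
  simp [shiftMap]

lemma shiftMap_map {W : MorphismProperty C} [W.IsCompatibleWithShift ℤ] {x y : C}
    (f : x ⟶ y) : shiftMap (W.Q.map f) = W.Q.map (f⟦(1 : ℤ)⟧') := by
  simp [shiftMap]

lemma resMap_shiftMap {W W' : MorphismProperty C} [W.IsCompatibleWithShift ℤ]
    [W'.IsCompatibleWithShift ℤ] [W.HasRightCalculusOfFractions] (h : W ≤ W') {x y : C}
    (φ : W.Q.obj x ⟶ W.Q.obj y) : resMap h (shiftMap φ) = shiftMap (resMap h φ) := by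
  obtain ⟨ψ, hψ⟩ := Localization.exists_rightFraction W.Q W φ
  have h₁ : W.Q.map ψ.s ≫ φ = W.Q.map ψ.f := by
    rw [hψ, MorphismProperty.RightFraction.map_s_comp_map]
  have h₂ := congrArg (fun t => resMap h (shiftMap t)) h₁
  have h₃ := congrArg (fun t => shiftMap (resMap h t)) h₁
  simp only [shiftMap_comp, resMap_comp, shiftMap_map, resMap_map] at h₂ h₃
  have : IsIso (W'.Q.map (ψ.s⟦(1 : ℤ)⟧')) :=
    W'.Q_inverts _ (W'.shift (h _ ψ.hs) 1)
  rw [← cancel_epi (W'.Q.map (ψ.s⟦(1 : ℤ)⟧')), h₂, h₃]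

end

variable [HasZeroObject C] [HasShift C ℤ] [Preadditive C]
  [∀ n : ℤ, (shiftFunctor C n).Additive] [Pretriangulated C]

/-! ### Morphisms with a cone in a thick subcategory -/

/-- If two distinguished triangles `x ⟶ m ⟶ y` and `w ⟶ m ⟶ z` have the same middle object,
then the composites `w ⟶ m ⟶ y` and `x ⟶ m ⟶ z` have the same cone, up to suspension. For
`m = x ⊞ y`, this says that the parallel sides of a homotopy cartesian square have the same
cones. -/
lemma trW_comp_iff_of_distinguished [IsTriangulated C] (P : ObjectProperty C)
    [P.IsStableUnderShift ℤ] [P.IsClosedUnderIsomorphisms] {x m y w z : C}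
    {i : x ⟶ m} {p : m ⟶ y} {δ : y ⟶ x⟦(1 : ℤ)⟧} (h : Triangle.mk i p δ ∈ distTriang C)
    {a : w ⟶ m} {g : m ⟶ z} {ε : z ⟶ w⟦(1 : ℤ)⟧} (h' : Triangle.mk a g ε ∈ distTriang C) :
    P.trW (a ≫ p) ↔ P.trW (i ≫ g) := by
  obtain ⟨c, α, β, hc⟩ := distinguished_cocone_triangle (a ≫ p)
  have o := Triangulated.someOctahedron rfl h' (rot_of_distTriang _ h) hc
  have h₁ : P.trW (a ≫ p) ↔ P c := P.trW_iff_of_distinguished _ hc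
  have h₂ : P.trW ((-i⟦(1 : ℤ)⟧') ≫ g⟦(1 : ℤ)⟧') ↔ P c :=
    P.trW_iff_of_distinguished' _ (rot_of_distTriang _ o.mem)
  rw [h₁, ← h₂]
  have : (-i⟦(1 : ℤ)⟧') ≫ g⟦(1 : ℤ)⟧' = (-1 : ℤˣ) • ((i ≫ g)⟦(1 : ℤ)⟧') := by
    simp [Units.smul_def]
  rw [this, P.smul_mem_trW_iff]
  exact ⟨fun h => h.unshift, fun h => h.shift 1⟩

lemma biprod_inr_fst_distinguished (x y : C) :
    Triangle.mk (biprod.inr : y ⟶ x ⊞ y) biprod.fst 0 ∈ distTriang C := by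
  refine isomorphic_distinguished _ (binaryBiproductTriangle_distinguished y x) _ ?_
  exact Triangle.isoMk _ _ (Iso.refl _) (biprod.braiding _ _) (Iso.refl _)
    (by change biprod.inr ≫ (biprod.braiding x y).hom = 𝟙 y ≫ biprod.inl; ext <;> simp)
    (by change biprod.fst ≫ 𝟙 x = (biprod.braiding x y).hom ≫ biprod.snd; simp)
    ((zero_comp).trans (comp_zero).symm)

/-- A morphism whose cone is an extension of `z'` by `z` factors as a morphism with cone `z`
followed by a morphism with cone `z'`. -/
lemma exists_fac_of_trW_extensionProduct [IsTriangulated C] (P P' : ObjectProperty C)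
    {x y : C} (s : x ⟶ y) (hs : (ObjectProperty.extensionProduct P P').trW s) :
    ∃ (c : C) (s' : x ⟶ c) (s'' : c ⟶ y), s' ≫ s'' = s ∧ P.trW s' ∧ P'.trW s'' := by
  obtain ⟨n, f, g, hT, ⟨z, z', a, b, d, hz, hP, hP'⟩⟩ := hs
  obtain ⟨c, s'', k, hc⟩ := distinguished_cocone_triangle₁ (f ≫ b)
  have o := Triangulated.someOctahedron' rfl hT hz hc
  exact ⟨c, o.m₁, s'', o.comm₁, ⟨_, _, _, o.mem, hP⟩, ⟨_, _, _, hc, hP'⟩⟩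

section

open ZeroObject

variable [IsTriangulated C] (P : ObjectProperty C) [P.IsTriangulated]

lemma isZero_Q_obj {z : C} (hz : P z) : IsZero (P.trW.Q.obj z) := by
  have h : P.trW (0 : (0 : C) ⟶ z) :=
    ⟨z, 𝟙 z, 0, contractible_distinguished₁ z, hz⟩
  have := P.trW.Q_inverts _ h
  exact (P.trW.Q.map_isZero (isZero_zero C)).of_iso (asIso (P.trW.Q.map (0 : (0 : C) ⟶ z))).symm

/-- A morphism which becomes zero in the Verdier quotient by `P` factors through an object
of `P`. -/
lemma exists_fac_of_Q_map_eq_zero {x y : C} (f : x ⟶ y) (hf : P.trW.Q.map f = 0) :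
    ∃ (z : C) (_ : P z) (a : x ⟶ z) (b : z ⟶ y), f = a ≫ b := by
  rw [← P.trW.Q.map_zero, MorphismProperty.map_eq_iff_postcomp P.trW.Q P.trW] at hf
  obtain ⟨y', s, hs, h⟩ := hf
  rw [ObjectProperty.trW_iff'] at hs
  obtain ⟨z, b, c, hT, hz⟩ := hs
  obtain ⟨a, ha⟩ := Triangle.coyoneda_exact₂ _ hT f (h.trans zero_comp)
  exact ⟨z, hz, a, b, ha⟩

variable [P.IsStableUnderRetracts]

lemma prop_of_isZero_Q_obj {x : C} (hx : IsZero (P.trW.Q.obj x)) : P x := by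
  obtain ⟨z, hz, a, b, h⟩ := exists_fac_of_Q_map_eq_zero P (𝟙 x) (hx.eq_of_src _ _)
  exact P.prop_of_retract ⟨a, b, h.symm⟩ hz

lemma trW_of_isIso_Q_map {x y : C} (f : x ⟶ y) [IsIso (P.trW.Q.map f)] : P.trW f := by
  obtain ⟨c, g, h, hT⟩ := distinguished_cocone_triangle f
  refine ⟨c, g, h, hT, prop_of_isZero_Q_obj P ?_⟩
  exact (Triangle.isZero₃_iff_isIso₁ _ (P.trW.Q.map_distinguished _ hT)).2
    (inferInstanceAs (IsIso (P.trW.Q.map f)))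

end

end

section

variable {C : Type u} [Category.{v} C] [HasZeroObject C] [HasShift C ℤ] [Preadditive C]
  [∀ n : ℤ, (shiftFunctor C n).Additive] [Pretriangulated C]

/-! ### Gluing along an orthogonal decomposition -/

/-- An extension of orthogonal objects splits, so that the order of the factors is irrelevant. -/
lemma extensionProduct_le_swap {J₁ J₂ : ObjectProperty C} [J₂.IsStableUnderShift ℤ]
    (h : J₂ ≤ J₁.rightOrthogonal) :
    ObjectProperty.extensionProduct J₂ J₁ ≤ ObjectProperty.extensionProduct J₁ J₂ := by
  rintro n ⟨z₂, z₁, f, g, k, hT, h₂, h₁⟩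
  obtain ⟨e, -⟩ := exists_iso_binaryBiproduct_of_distTriang _ hT
    (h _ (J₂.le_shift 1 _ h₂) k h₁)
  exact ObjectProperty.prop_of_iso _ e.symm
    ⟨_, _, _, _, _, biprod_inr_fst_distinguished z₂ z₁, h₁, h₂⟩

/-- The subcategory `J` is the orthogonal sum of `J₁` and `J₂`: there are no nonzero morphisms
between `J₁` and `J₂` in either direction, and every object of `J` is an extension (hence a direct
sum) of an object of `J₂` by an object of `J₁`. -/
structure IsOrthogonalSum (J₁ J₂ J : ObjectProperty C) : Prop where
  le₁ : J₁ ≤ J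
  le₂ : J₂ ≤ J
  orth₁ : J₁ ≤ J₂.rightOrthogonal
  orth₂ : J₂ ≤ J₁.rightOrthogonal
  le : J ≤ ObjectProperty.extensionProduct J₁ J₂

namespace IsOrthogonalSum

variable {J₁ J₂ J : ObjectProperty C}

lemma exists_decomp [J₁.IsStableUnderShift ℤ] (hJ : IsOrthogonalSum J₁ J₂ J) {n : C}
    (hn : J n) : ∃ (z₁ z₂ : C) (_ : J₁ z₁) (_ : J₂ z₂), Nonempty (n ≅ z₁ ⊞ z₂) := by
  obtain ⟨z₁, z₂, f, g, k, hT, h₁, h₂⟩ := hJ.le n hn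
  obtain ⟨e, -⟩ := exists_iso_binaryBiproduct_of_distTriang _ hT
    (hJ.orth₁ _ (J₁.le_shift 1 _ h₁) k h₂)
  exact ⟨z₁, z₂, h₁, h₂, ⟨e⟩⟩

lemma symm [J₁.IsStableUnderShift ℤ] (hJ : IsOrthogonalSum J₁ J₂ J) :
    IsOrthogonalSum J₂ J₁ J where
  le₁ := hJ.le₂
  le₂ := hJ.le₁
  orth₁ := hJ.orth₂
  orth₂ := hJ.orth₁
  le := hJ.le.trans (extensionProduct_le_swap hJ.orth₁)

lemma exists_add_eq_id [J₁.IsStableUnderShift ℤ] (hJ : IsOrthogonalSum J₁ J₂ J) {n : C}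
    (hn : J n) : ∃ (z₁ z₂ : C) (_ : J₁ z₁) (_ : J₂ z₂) (p₁ : n ⟶ z₁) (i₁ : z₁ ⟶ n)
      (p₂ : n ⟶ z₂) (i₂ : z₂ ⟶ n), p₁ ≫ i₁ + p₂ ≫ i₂ = 𝟙 n := by
  obtain ⟨z₁, z₂, h₁, h₂, ⟨e⟩⟩ := hJ.exists_decomp hn
  refine ⟨z₁, z₂, h₁, h₂, e.hom ≫ biprod.fst, biprod.inl ≫ e.inv, e.hom ≫ biprod.snd,
    biprod.inr ≫ e.inv, ?_⟩
  simp only [assoc, ← Preadditive.comp_add]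
  simp only [← assoc, ← Preadditive.add_comp, biprod.total, comp_id, e.hom_inv_id]

/-- Since the cone of `l` is left orthogonal to `z`, morphisms to `z` extend along `l`. -/
lemma exists_comp_eq_of_trW [J₂.IsTriangulated] (hJ : IsOrthogonalSum J₁ J₂ J)
    {w x z : C} (l : w ⟶ x) (hl : J₂.trW l) (hz : J₁ z) (u : w ⟶ z) :
    ∃ t : x ⟶ z, l ≫ t = u := by
  have : J₂.trW.isLocal z := by
    rw [ObjectProperty.isLocal_trW]
    exact hJ.orth₁ z hz
  exact (this l hl).2 u

variable [IsTriangulated C] [J₁.IsTriangulated] [J₂.IsTriangulated]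

/-- A morphism of `C` which becomes invertible in both Verdier quotients is invertible. -/
lemma isIso_of_isIso_Q_map [J₁.IsClosedUnderIsomorphisms]
    [J₂.IsClosedUnderIsomorphisms] [J₁.IsStableUnderRetracts] [J₂.IsStableUnderRetracts]
    (hJ : IsOrthogonalSum J₁ J₂ J) {x y : C}
    (f : x ⟶ y) (h₁ : IsIso (J₁.trW.Q.map f)) (h₂ : IsIso (J₂.trW.Q.map f)) : IsIso f := by
  obtain ⟨c, g, k, hT⟩ := distinguished_cocone_triangle f
  have hc₁ : J₁ c := (J₁.trW_iff_of_distinguished _ hT).1 (trW_of_isIso_Q_map J₁ f)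
  have hc₂ : J₂ c := (J₂.trW_iff_of_distinguished _ hT).1 (trW_of_isIso_Q_map J₂ f)
  exact (Triangle.isZero₃_iff_isIso₁ _ hT).1
    ((IsZero.iff_id_eq_zero c).2 (hJ.orth₁ c hc₁ (𝟙 c) hc₂))

/-- The composition of a morphism which vanishes in the quotient by `J₁` and a morphism which
vanishes in the quotient by `J₂` is zero, as the former factors through `J₁` and the latter
through `J₂`. -/
lemma comp_eq_zero (hJ : IsOrthogonalSum J₁ J₂ J) {x y z : C} (f : x ⟶ y) (g : y ⟶ z)
    (hf : J₁.trW.Q.map f = 0) (hg : J₂.trW.Q.map g = 0) : f ≫ g = 0 := by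
  obtain ⟨z₁, hz₁, a, b, rfl⟩ := exists_fac_of_Q_map_eq_zero J₁ f hf
  obtain ⟨z₂, hz₂, c, d, rfl⟩ := exists_fac_of_Q_map_eq_zero J₂ g hg
  have : b ≫ c = 0 := hJ.orth₂ _ hz₂ _ hz₁
  rw [assoc, reassoc_of% this, zero_comp, comp_zero]

variable [J.IsTriangulated] [J₁.IsClosedUnderIsomorphisms] [J₂.IsClosedUnderIsomorphisms]

/-- Morphisms in the two Verdier quotients which agree in the common quotient come from a
morphism of `C`. -/
theorem exists_lift (hJ : IsOrthogonalSum J₁ J₂ J) {x y : C} (φ₁ : J₁.trW.Q.obj x ⟶ J₁.trW.Q.obj y)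
    (φ₂ : J₂.trW.Q.obj x ⟶ J₂.trW.Q.obj y)
    (h : resMap (ObjectProperty.trW_monotone hJ.le₁) φ₁ =
      resMap (ObjectProperty.trW_monotone hJ.le₂) φ₂) :
    ∃ f : x ⟶ y, J₁.trW.Q.map f = φ₁ ∧ J₂.trW.Q.map f = φ₂ := by
  obtain ⟨ψ₁, hψ₁⟩ := Localization.exists_rightFraction J₁.trW.Q J₁.trW φ₁
  obtain ⟨ψ₂, hψ₂⟩ := Localization.exists_rightFraction J₂.trW.Q J₂.trW φ₂
  have e₁ : J₁.trW.Q.map ψ₁.s ≫ φ₁ = J₁.trW.Q.map ψ₁.f := by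
    rw [hψ₁, MorphismProperty.RightFraction.map_s_comp_map]
  have e₂ : J₂.trW.Q.map ψ₂.s ≫ φ₂ = J₂.trW.Q.map ψ₂.f := by
    rw [hψ₂, MorphismProperty.RightFraction.map_s_comp_map]
  obtain @⟨x₁, s₁, hs₁, f₁⟩ := ψ₁
  obtain @⟨x₂, s₂, hs₂, f₂⟩ := ψ₂
  dsimp only at e₁ e₂
  clear hψ₁ hψ₂
  -- the homotopy pullback `w` of `s₁` and `s₂`
  obtain ⟨w, a, δ, hT⟩ := distinguished_cocone_triangle₁ (biprod.desc s₁ (-s₂))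
  have hl₁ : J₂.trW (a ≫ biprod.fst) := by
    rw [trW_comp_iff_of_distinguished J₂ (biprod_inr_fst_distinguished x₁ x₂) hT]
    simpa [Units.smul_def] using (J₂.smul_mem_trW_iff s₂ (-1)).2 hs₂
  have hl₂ : J₁.trW (a ≫ biprod.snd) := by
    rw [trW_comp_iff_of_distinguished J₁ (binaryBiproductTriangle_distinguished x₁ x₂) hT]
    simpa using hs₁
  have hw : (a ≫ biprod.fst) ≫ s₁ = (a ≫ biprod.snd) ≫ s₂ := by
    have : a ≫ biprod.desc s₁ (-s₂) = 0 := comp_distTriang_mor_zero₁₂ _ hT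
    rw [← sub_eq_zero, ← this, biprod.desc_eq]
    simp [sub_eq_add_neg]
  have ha : a = biprod.lift (a ≫ biprod.fst) (a ≫ biprod.snd) := by ext <;> simp
  generalize a ≫ biprod.fst = l₁ at hl₁ hw ha
  generalize a ≫ biprod.snd = l₂ at hl₂ hw ha
  subst ha
  -- the two morphisms `w ⟶ y` agree in the quotient by `J`
  have hδ : J.trW.Q.map (l₁ ≫ f₁ - l₂ ≫ f₂) = 0 := by
    have e₁' := congrArg (resMap (ObjectProperty.trW_monotone hJ.le₁)) e₁
    have e₂' := congrArg (resMap (ObjectProperty.trW_monotone hJ.le₂)) e₂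
    rw [resMap_comp, resMap_map, resMap_map] at e₁' e₂'
    rw [Functor.map_sub, Functor.map_comp, Functor.map_comp, ← e₁', ← e₂', h, ← assoc, ← assoc,
      ← Functor.map_comp, ← Functor.map_comp, hw, sub_self]
  obtain ⟨n, hn, u, v, huv⟩ := exists_fac_of_Q_map_eq_zero J _ hδ
  -- the difference splits into a part through `J₁` and a part through `J₂`, which extend to `x₁`
  -- and `x₂` respectively and can be absorbed into `f₁` and `f₂`
  obtain ⟨z₁, z₂, hz₁, hz₂, p₁, i₁, p₂, i₂, hid⟩ := hJ.exists_add_eq_id hn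
  obtain ⟨t₁, ht₁⟩ := hJ.exists_comp_eq_of_trW l₁ hl₁ hz₁ (u ≫ p₁)
  obtain ⟨t₂, ht₂⟩ := hJ.symm.exists_comp_eq_of_trW l₂ hl₂ hz₂ (u ≫ p₂)
  have hsum : l₁ ≫ f₁ - l₂ ≫ f₂ = l₁ ≫ t₁ ≫ i₁ ≫ v + l₂ ≫ t₂ ≫ i₂ ≫ v := by
    rw [huv, reassoc_of% ht₁, reassoc_of% ht₂, ← Preadditive.comp_add, ← assoc p₁, ← assoc p₂,
      ← Preadditive.add_comp, hid, id_comp]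
  obtain ⟨f, hf⟩ : ∃ f : x ⟶ y, biprod.desc (f₁ - t₁ ≫ i₁ ≫ v) (-(f₂ + t₂ ≫ i₂ ≫ v)) =
      biprod.desc s₁ (-s₂) ≫ f :=
    Triangle.yoneda_exact₂ _ hT _ (by
      change biprod.lift l₁ l₂ ≫ biprod.desc _ _ = 0
      rw [biprod.lift_desc, Preadditive.comp_sub, Preadditive.comp_neg, Preadditive.comp_add,
        sub_eq_iff_eq_add.1 hsum]
      abel)
  refine ⟨f, ?_, ?_⟩
  · have h₁ : f₁ - t₁ ≫ i₁ ≫ v = s₁ ≫ f := by simpa using congrArg (biprod.inl ≫ ·) hf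
    have := J₁.trW.Q_inverts s₁ hs₁
    rw [← cancel_epi (J₁.trW.Q.map s₁), e₁, ← Functor.map_comp, ← h₁, Functor.map_sub,
      Functor.map_comp _ t₁, (isZero_Q_obj J₁ hz₁).eq_of_tgt (J₁.trW.Q.map t₁) 0, zero_comp,
      sub_zero]
  · have h₂ : f₂ + t₂ ≫ i₂ ≫ v = s₂ ≫ f := by
      rw [← neg_inj, ← Preadditive.neg_comp]
      simpa only [biprod.inr_desc, biprod.inr_desc_assoc] using congrArg (biprod.inr ≫ ·) hf
    have := J₂.trW.Q_inverts s₂ hs₂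
    rw [← cancel_epi (J₂.trW.Q.map s₂), e₂, ← Functor.map_comp, ← h₂, Functor.map_add,
      Functor.map_comp _ t₂, (isZero_Q_obj J₂ hz₂).eq_of_tgt (J₂.trW.Q.map t₂) 0, zero_comp,
      add_zero]

/-- Objects of `C` which are isomorphic in the common quotient can be glued. -/
theorem exists_glue (hJ : IsOrthogonalSum J₁ J₂ J) [J.IsStableUnderRetracts] {y₁ y₂ : C}
    (σ : J.trW.Q.obj y₁ ⟶ J.trW.Q.obj y₂) [IsIso σ] :
    ∃ (d : C) (h₁ : J₁.trW.Q.obj d ≅ J₁.trW.Q.obj y₁) (h₂ : J₂.trW.Q.obj d ≅ J₂.trW.Q.obj y₂),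
      resMap (ObjectProperty.trW_monotone hJ.le₁) h₁.hom ≫ σ =
        resMap (ObjectProperty.trW_monotone hJ.le₂) h₂.hom := by
  have hle₁ := ObjectProperty.trW_monotone hJ.le₁
  have hle₂ := ObjectProperty.trW_monotone hJ.le₂
  obtain ⟨ψ, hψ⟩ := Localization.exists_rightFraction J.trW.Q J.trW σ
  have e : J.trW.Q.map ψ.s ≫ σ = J.trW.Q.map ψ.f := by
    rw [hψ, MorphismProperty.RightFraction.map_s_comp_map]
  obtain @⟨c, s, hs, t⟩ := ψ
  dsimp only at e
  have ht : J.trW t := by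
    have := J.trW.Q_inverts s hs
    have : IsIso (J.trW.Q.map t) := by
      rw [← e]
      infer_instance
    exact trW_of_isIso_Q_map J t
  clear hψ
  -- `y₁` and `y₂` are replaced by `c₁` and `c₂`, which agree with them in the respective quotients
  obtain ⟨c₁, s', s'', rfl, hs', hs''⟩ := exists_fac_of_trW_extensionProduct J₂ J₁ s
    (ObjectProperty.trW_monotone hJ.symm.le _ hs)
  obtain ⟨c₂, t', t'', rfl, ht', ht''⟩ := exists_fac_of_trW_extensionProduct J₁ J₂ t
    (ObjectProperty.trW_monotone hJ.le _ ht)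
  -- the homotopy pushout `d` of `s'` and `t'`
  obtain ⟨d, g, δ, hT⟩ := distinguished_cocone_triangle (biprod.lift s' (-t'))
  have hk₁ : J₁.trW (biprod.inl ≫ g) := by
    rw [← trW_comp_iff_of_distinguished J₁ (binaryBiproductTriangle_distinguished c₁ c₂) hT]
    simpa [Units.smul_def] using (J₁.smul_mem_trW_iff t' (-1)).2 ht'
  have hk₂ : J₂.trW (biprod.inr ≫ g) := by
    rw [← trW_comp_iff_of_distinguished J₂ (biprod_inr_fst_distinguished c₁ c₂) hT]
    simpa using hs'
  have hcomm : s' ≫ biprod.inl ≫ g = t' ≫ biprod.inr ≫ g := by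
    have : biprod.lift s' (-t') ≫ g = 0 := comp_distTriang_mor_zero₁₂ _ hT
    rw [← sub_eq_zero, ← this, biprod.lift_eq]
    simp [sub_eq_add_neg]
  have := J₁.trW.Q_inverts _ hk₁
  have := J₂.trW.Q_inverts _ hk₂
  have := J₁.trW.Q_inverts _ hs''
  have := J₂.trW.Q_inverts _ ht''
  have := J.trW.Q_inverts _ (hle₁ _ hk₁)
  have := J.trW.Q_inverts _ (hle₂ _ hs')
  let h₁ := (asIso (J₁.trW.Q.map (biprod.inl ≫ g))).symm ≪≫ asIso (J₁.trW.Q.map s'')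
  let h₂ := (asIso (J₂.trW.Q.map (biprod.inr ≫ g))).symm ≪≫ asIso (J₂.trW.Q.map t'')
  have e₁ : J₁.trW.Q.map (biprod.inl ≫ g) ≫ h₁.hom = J₁.trW.Q.map s'' := by
    simp [h₁]
  have e₂ : J₂.trW.Q.map (biprod.inr ≫ g) ≫ h₂.hom = J₂.trW.Q.map t'' := by
    simp [h₂]
  refine ⟨d, h₁, h₂, ?_⟩
  have e₁' := congrArg (resMap hle₁) e₁
  have e₂' := congrArg (resMap hle₂) e₂
  rw [resMap_comp, resMap_map, resMap_map] at e₁' e₂'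
  rw [← cancel_epi (J.trW.Q.map (biprod.inl ≫ g)), reassoc_of% e₁',
    ← cancel_epi (J.trW.Q.map s'), ← assoc (J.trW.Q.map s'), ← assoc (J.trW.Q.map s'),
    ← Functor.map_comp, ← Functor.map_comp, e, hcomm, Functor.map_comp, Functor.map_comp, assoc,
    e₂']

end IsOrthogonalSum

end

/-! ### Idempotents -/

section

variable {D : Type u} [Category.{v} D] [HasZeroObject D] [HasShift D ℤ] [Preadditive D]
  [∀ n : ℤ, (shiftFunctor D n).Additive] [Pretriangulated D]

/-- For an idempotent `e` of an object `x` of a pretriangulated category, the direct sum of the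
formal image of `e` and of its suspension is an object of the category, namely the cone `y` of
`1 - e`: the morphisms `i`, `p`, `j` and `q` are the inclusions and the projections. -/
theorem exists_image_sum_shift_image {x : D} (e : x ⟶ x) (he : e ≫ e = e) :
    ∃ (y : D) (i : x ⟶ y) (p : y ⟶ x) (j : x⟦(1 : ℤ)⟧ ⟶ y) (q : y ⟶ x⟦(1 : ℤ)⟧),
      i ≫ p = e ∧ j ≫ q = e⟦(1 : ℤ)⟧' ∧ i ≫ q = 0 ∧ j ≫ p = 0 ∧
      e ≫ i = i ∧ p ≫ e = p ∧ e⟦(1 : ℤ)⟧' ≫ j = j ∧ q ≫ e⟦(1 : ℤ)⟧' = q ∧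
      p ≫ i + q ≫ j = 𝟙 y := by
  obtain ⟨y, i, q, hT⟩ := distinguished_cocone_triangle (𝟙 x - e)
  have hi : (𝟙 x - e) ≫ i = 0 := comp_distTriang_mor_zero₁₂ _ hT
  have hiq : i ≫ q = 0 := comp_distTriang_mor_zero₂₃ _ hT
  have hq : q ≫ (𝟙 x - e)⟦(1 : ℤ)⟧' = 0 := comp_distTriang_mor_zero₃₁ _ hT
  have hei : e ≫ i = i := by
    rw [Preadditive.sub_comp, id_comp, sub_eq_zero] at hi
    exact hi.symm
  have hqe : q ≫ e⟦(1 : ℤ)⟧' = q := by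
    rw [Functor.map_sub, CategoryTheory.Functor.map_id, Preadditive.comp_sub, comp_id,
      sub_eq_zero] at hq
    exact hq.symm
  have hee : e⟦(1 : ℤ)⟧' ≫ e⟦(1 : ℤ)⟧' = e⟦(1 : ℤ)⟧' := by rw [← Functor.map_comp, he]
  obtain ⟨p₀, hp₀⟩ : ∃ p₀ : y ⟶ x, e = i ≫ p₀ :=
    Triangle.yoneda_exact₂ _ hT e (by
      change (𝟙 x - e) ≫ e = 0
      rw [Preadditive.sub_comp, id_comp, he, sub_self])
  obtain ⟨j₀, hj₀⟩ : ∃ j₀ : x⟦(1 : ℤ)⟧ ⟶ y, e⟦(1 : ℤ)⟧' = j₀ ≫ q :=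
    Triangle.coyoneda_exact₁ _ hT (e⟦(1 : ℤ)⟧') (by
      change e⟦(1 : ℤ)⟧' ≫ (𝟙 x - e)⟦(1 : ℤ)⟧' = 0
      rw [← Functor.map_comp, Preadditive.comp_sub, comp_id, he, sub_self, Functor.map_zero])
  obtain ⟨p, hip, hpe⟩ : ∃ p : y ⟶ x, i ≫ p = e ∧ p ≫ e = p :=
    ⟨p₀ ≫ e, by rw [← assoc, ← hp₀, he], by rw [assoc, he]⟩
  obtain ⟨j, hjq, hej, hjp⟩ : ∃ j : x⟦(1 : ℤ)⟧ ⟶ y, j ≫ q = e⟦(1 : ℤ)⟧' ∧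
      e⟦(1 : ℤ)⟧' ≫ j = j ∧ j ≫ p = 0 := by
    refine ⟨e⟦(1 : ℤ)⟧' ≫ (j₀ - j₀ ≫ p ≫ i), ?_, ?_, ?_⟩
    · rw [assoc, Preadditive.sub_comp, ← hj₀, assoc, assoc, hiq, comp_zero, comp_zero, sub_zero,
        hee]
    · rw [← assoc, hee]
    · rw [assoc, Preadditive.sub_comp, assoc, assoc, hip, hpe, sub_self, comp_zero]
  refine ⟨y, i, p, j, q, hip, hjq, hiq, hjp, hei, hpe, hej, hqe, ?_⟩
  -- the defect `δ` is idempotent, and it has square zero as it factors through `i`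
  obtain ⟨δ, hδ⟩ : ∃ δ, δ = 𝟙 y - (p ≫ i + q ≫ j) := ⟨_, rfl⟩
  have hiδ : i ≫ δ = 0 := by
    rw [hδ, Preadditive.comp_sub, Preadditive.comp_add, comp_id, reassoc_of% hip,
      reassoc_of% hiq, hei, zero_comp, add_zero, sub_self]
  have hjδ : j ≫ δ = 0 := by
    rw [hδ, Preadditive.comp_sub, Preadditive.comp_add, comp_id, reassoc_of% hjq,
      reassoc_of% hjp, hej, zero_comp, zero_add, sub_self]
  have hδq : δ ≫ q = 0 := by
    rw [hδ, Preadditive.sub_comp, Preadditive.add_comp, id_comp, assoc, assoc, hiq, hjq, hqe,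
      comp_zero, zero_add, sub_self]
  obtain ⟨u, hu⟩ : ∃ u : y ⟶ x, δ = u ≫ i := Triangle.coyoneda_exact₃ _ hT δ hδq
  have h₁ : δ ≫ δ = 0 := by
    rw [← comp_zero (f := u), ← hiδ, ← assoc, ← hu]
  have h₂ : δ ≫ δ = δ := by
    conv_lhs => congr; rw [hδ]
    rw [Preadditive.sub_comp, Preadditive.add_comp, id_comp, assoc, assoc, hiδ, hjδ]
    simp
  rw [h₁, hδ] at h₂
  exact (sub_eq_zero.1 h₂.symm).symm

end

section

variable {C : Type u} [Category.{v} C] [HasZeroObject C] [HasShift C ℤ] [Preadditive C]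
  [∀ n : ℤ, (shiftFunctor C n).Additive] [Pretriangulated C] [IsTriangulated C]

/-- Variant of `exists_image_sum_shift_image` for a Verdier quotient, in terms of objects of the
original category. -/
lemma exists_image_sum_shift_image_Q (P : ObjectProperty C) [P.IsTriangulated] {x : C}
    (e : P.trW.Q.obj x ⟶ P.trW.Q.obj x) (he : e ≫ e = e) :
    ∃ (y : C) (i : P.trW.Q.obj x ⟶ P.trW.Q.obj y) (p : P.trW.Q.obj y ⟶ P.trW.Q.obj x)
      (j : P.trW.Q.obj (x⟦(1 : ℤ)⟧) ⟶ P.trW.Q.obj y)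
      (q : P.trW.Q.obj y ⟶ P.trW.Q.obj (x⟦(1 : ℤ)⟧)),
      i ≫ p = e ∧ j ≫ q = shiftMap e ∧ i ≫ q = 0 ∧ j ≫ p = 0 ∧
      e ≫ i = i ∧ p ≫ e = p ∧ shiftMap e ≫ j = j ∧ q ≫ shiftMap e = q ∧
      p ≫ i + q ≫ j = 𝟙 _ := by
  obtain ⟨y', i, p, j, q, hip, hjq, hiq, hjp, hei, hpe, hej, hqe, h⟩ :=
    exists_image_sum_shift_image e he
  obtain ⟨y, rfl⟩ : ∃ y, P.trW.Q.obj y = y' :=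
    ⟨_, (Localization.Construction.objEquiv P.trW).apply_symm_apply y'⟩
  refine ⟨y, i, p, (P.trW.Q.commShiftIso (1 : ℤ)).hom.app x ≫ j,
    q ≫ (P.trW.Q.commShiftIso (1 : ℤ)).inv.app x, hip, ?_, ?_, ?_, hei, hpe, ?_, ?_, ?_⟩
  · rw [assoc, reassoc_of% hjq]
    rfl
  · rw [reassoc_of% hiq, zero_comp]
  · rw [assoc, hjp, comp_zero]
  · simp [shiftMap, hej]
  · simp [shiftMap, reassoc_of% hqe]
  · simpa using h

/-- The ring homomorphism between endomorphism rings given by an additive functor. -/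
def mapEndRingHom {D E : Type*} [Category* D] [Category* E] [Preadditive D] [Preadditive E]
    (F : D ⥤ E) [F.Additive] (x : D) : End x →+* End (F.obj x) :=
  { F.mapEnd x, (F.mapAddHom : (x ⟶ x) →+ _) with }

namespace IsOrthogonalSum

variable {J₁ J₂ J : ObjectProperty C} [J₁.IsTriangulated] [J₂.IsTriangulated] [J.IsTriangulated]

/-- An isomorphism between formal images of idempotents in the common quotient extends to an
isomorphism between the direct sums of these images and of their suspensions. -/
lemma exists_iso_image_sum_shift_image (hJ : IsOrthogonalSum J₁ J₂ J) {x₁ x₂ : C}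
    (e₁ : J₁.trW.Q.obj x₁ ⟶ J₁.trW.Q.obj x₁) (he₁ : e₁ ≫ e₁ = e₁)
    (e₂ : J₂.trW.Q.obj x₂ ⟶ J₂.trW.Q.obj x₂) (he₂ : e₂ ≫ e₂ = e₂)
    (σ : J.trW.Q.obj x₁ ⟶ J.trW.Q.obj x₂) (τ : J.trW.Q.obj x₂ ⟶ J.trW.Q.obj x₁)
    (hσ : σ ≫ resMap (ObjectProperty.trW_monotone hJ.le₂) e₂ = σ)
    (hτ : τ ≫ resMap (ObjectProperty.trW_monotone hJ.le₁) e₁ = τ)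
    (hστ : σ ≫ τ = resMap (ObjectProperty.trW_monotone hJ.le₁) e₁)
    (hτσ : τ ≫ σ = resMap (ObjectProperty.trW_monotone hJ.le₂) e₂) :
    ∃ (y₁ y₂ : C) (i₁ : J₁.trW.Q.obj x₁ ⟶ J₁.trW.Q.obj y₁)
      (p₁ : J₁.trW.Q.obj y₁ ⟶ J₁.trW.Q.obj x₁)
      (i₂ : J₂.trW.Q.obj x₂ ⟶ J₂.trW.Q.obj y₂) (p₂ : J₂.trW.Q.obj y₂ ⟶ J₂.trW.Q.obj x₂)
      (θ : J.trW.Q.obj y₁ ≅ J.trW.Q.obj y₂), i₁ ≫ p₁ = e₁ ∧ i₂ ≫ p₂ = e₂ ∧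
      p₁ ≫ e₁ = p₁ ∧ p₂ ≫ e₂ = p₂ ∧
      resMap (ObjectProperty.trW_monotone hJ.le₁) i₁ ≫ θ.hom =
        σ ≫ resMap (ObjectProperty.trW_monotone hJ.le₂) i₂ ∧
      θ.hom ≫ resMap (ObjectProperty.trW_monotone hJ.le₂) p₂ =
        resMap (ObjectProperty.trW_monotone hJ.le₁) p₁ ≫ σ := by
  have hle₁ := ObjectProperty.trW_monotone hJ.le₁
  have hle₂ := ObjectProperty.trW_monotone hJ.le₂
  obtain ⟨y₁, i₁, p₁, j₁, q₁, hip₁, hjq₁, hiq₁, hjp₁, hei₁, hpe₁, hej₁, hqe₁, h₁⟩ :=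
    exists_image_sum_shift_image_Q J₁ e₁ he₁
  obtain ⟨y₂, i₂, p₂, j₂, q₂, hip₂, hjq₂, hiq₂, hjp₂, hei₂, hpe₂, hej₂, hqe₂, h₂⟩ :=
    exists_image_sum_shift_image_Q J₂ e₂ he₂
  -- all the relations hold in the common quotient
  have hip₁' := congrArg (resMap hle₁) hip₁
  have hjq₁' := congrArg (resMap hle₁) hjq₁
  have hiq₁' := congrArg (resMap hle₁) hiq₁
  have hjp₁' := congrArg (resMap hle₁) hjp₁
  have hei₁' := congrArg (resMap hle₁) hei₁
  have hej₁' := congrArg (resMap hle₁) hej₁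
  have h₁' := congrArg (resMap hle₁) h₁
  have hip₂' := congrArg (resMap hle₂) hip₂
  have hjq₂' := congrArg (resMap hle₂) hjq₂
  have hiq₂' := congrArg (resMap hle₂) hiq₂
  have hjp₂' := congrArg (resMap hle₂) hjp₂
  have hei₂' := congrArg (resMap hle₂) hei₂
  have hej₂' := congrArg (resMap hle₂) hej₂
  have h₂' := congrArg (resMap hle₂) h₂
  have hz₁ {x y : C} : resMap hle₁ (0 : J₁.trW.Q.obj x ⟶ J₁.trW.Q.obj y) = 0 := by
    rw [← Functor.map_zero, resMap_map, Functor.map_zero]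
  have hz₂ {x y : C} : resMap hle₂ (0 : J₂.trW.Q.obj x ⟶ J₂.trW.Q.obj y) = 0 := by
    rw [← Functor.map_zero, resMap_map, Functor.map_zero]
  simp only [resMap_comp, resMap_shiftMap, hz₁] at hip₁' hjq₁' hiq₁' hjp₁' hei₁' hej₁'
  simp only [resMap_comp, resMap_shiftMap, hz₂] at hip₂' hjq₂' hiq₂' hjp₂' hei₂' hej₂'
  simp only [resMap_add, resMap_comp, resMap_id] at h₁' h₂'
  have hσs := congrArg shiftMap hσ
  have hτs := congrArg shiftMap hτ
  have hστs := congrArg shiftMap hστ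
  have hτσs := congrArg shiftMap hτσ
  rw [shiftMap_comp] at hσs hτs hστs hτσs
  refine ⟨y₁, y₂, i₁, p₁, i₂, p₂,
    ⟨resMap hle₁ p₁ ≫ σ ≫ resMap hle₂ i₂ + resMap hle₁ q₁ ≫ shiftMap σ ≫ resMap hle₂ j₂,
      resMap hle₂ p₂ ≫ τ ≫ resMap hle₁ i₁ + resMap hle₂ q₂ ≫ shiftMap τ ≫ resMap hle₁ j₁,
      ?_, ?_⟩, hip₁, hip₂, hpe₁, hpe₂, ?_, ?_⟩
  · simp only [Preadditive.add_comp, Preadditive.comp_add, assoc, reassoc_of% hip₂',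
      reassoc_of% hjq₂', reassoc_of% hiq₂', reassoc_of% hjp₂', zero_comp, comp_zero, add_zero,
      zero_add, reassoc_of% hσ, reassoc_of% hσs, reassoc_of% hστ, reassoc_of% hστs, hei₁', hej₁',
      h₁']
  · simp only [Preadditive.add_comp, Preadditive.comp_add, assoc, reassoc_of% hip₁',
      reassoc_of% hjq₁', reassoc_of% hiq₁', reassoc_of% hjp₁', zero_comp, comp_zero, add_zero,
      zero_add, reassoc_of% hτ, reassoc_of% hτs, reassoc_of% hτσ, reassoc_of% hτσs, hei₂', hej₂',
      h₂']
  · have hσ' : resMap hle₁ e₁ ≫ σ = σ := by rw [← hστ, assoc, hτσ, hσ]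
    simp only [Preadditive.comp_add, reassoc_of% hip₁', reassoc_of% hiq₁', reassoc_of% hσ',
      zero_comp, add_zero]
  · simp only [Preadditive.add_comp, assoc, hip₂', hjp₂', hσ, comp_zero, add_zero]

variable [J₁.IsClosedUnderIsomorphisms] [J₂.IsClosedUnderIsomorphisms]

/-- Idempotents in the two Verdier quotients which agree in the common quotient come from an
idempotent of `C`: a common lift exists by `exists_lift`, and it is unique up to an ideal of
square zero. -/
lemma exists_idempotent_lift (hJ : IsOrthogonalSum J₁ J₂ J) {d : C}
    (e₁ : J₁.trW.Q.obj d ⟶ J₁.trW.Q.obj d) (he₁ : e₁ ≫ e₁ = e₁)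
    (e₂ : J₂.trW.Q.obj d ⟶ J₂.trW.Q.obj d) (he₂ : e₂ ≫ e₂ = e₂)
    (h : resMap (ObjectProperty.trW_monotone hJ.le₁) e₁ =
      resMap (ObjectProperty.trW_monotone hJ.le₂) e₂) :
    ∃ e : d ⟶ d, e ≫ e = e ∧ J₁.trW.Q.map e = e₁ ∧ J₂.trW.Q.map e = e₂ := by
  obtain ⟨f, hf₁, hf₂⟩ := hJ.exists_lift e₁ e₂ h
  let φ : End d →+* End (J₁.trW.Q.obj d) × End (J₂.trW.Q.obj d) :=
    (mapEndRingHom J₁.trW.Q d).prod (mapEndRingHom J₂.trW.Q d)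
  obtain ⟨e, he, hφ⟩ := exists_isIdempotentElem_eq_of_ker_isNilpotent φ
    (fun g hg => ⟨2, by
      rw [pow_two]
      exact hJ.comp_eq_zero g g (congrArg Prod.fst hg) (congrArg Prod.snd hg)⟩)
    (e₁, e₂) ⟨f, Prod.ext hf₁ hf₂⟩ (Prod.ext he₁ he₂)
  exact ⟨e, he, congrArg Prod.fst hφ, congrArg Prod.snd hφ⟩

/-- Formal images of idempotents of the two Verdier quotients which are isomorphic in the common
quotient can be glued. -/
theorem exists_glue_of_idempotent [J.IsStableUnderRetracts] [IsIdempotentComplete C]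
    (hJ : IsOrthogonalSum J₁ J₂ J) {x₁ x₂ : C}
    (e₁ : J₁.trW.Q.obj x₁ ⟶ J₁.trW.Q.obj x₁) (he₁ : e₁ ≫ e₁ = e₁)
    (e₂ : J₂.trW.Q.obj x₂ ⟶ J₂.trW.Q.obj x₂) (he₂ : e₂ ≫ e₂ = e₂)
    (σ : J.trW.Q.obj x₁ ⟶ J.trW.Q.obj x₂) (τ : J.trW.Q.obj x₂ ⟶ J.trW.Q.obj x₁)
    (hσ : σ ≫ resMap (ObjectProperty.trW_monotone hJ.le₂) e₂ = σ)
    (hτ : τ ≫ resMap (ObjectProperty.trW_monotone hJ.le₁) e₁ = τ)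
    (hστ : σ ≫ τ = resMap (ObjectProperty.trW_monotone hJ.le₁) e₁)
    (hτσ : τ ≫ σ = resMap (ObjectProperty.trW_monotone hJ.le₂) e₂) :
    ∃ (a : C) (f₁ : J₁.trW.Q.obj a ⟶ J₁.trW.Q.obj x₁) (g₁ : J₁.trW.Q.obj x₁ ⟶ J₁.trW.Q.obj a)
      (f₂ : J₂.trW.Q.obj a ⟶ J₂.trW.Q.obj x₂) (g₂ : J₂.trW.Q.obj x₂ ⟶ J₂.trW.Q.obj a),
      f₁ ≫ g₁ = 𝟙 _ ∧ g₁ ≫ f₁ = e₁ ∧ f₂ ≫ g₂ = 𝟙 _ ∧ g₂ ≫ f₂ = e₂ ∧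
      resMap (ObjectProperty.trW_monotone hJ.le₁) f₁ ≫ σ =
        resMap (ObjectProperty.trW_monotone hJ.le₂) f₂ := by
  have hle₁ := ObjectProperty.trW_monotone hJ.le₁
  have hle₂ := ObjectProperty.trW_monotone hJ.le₂
  obtain ⟨y₁, y₂, i₁, p₁, i₂, p₂, θ, hip₁, hip₂, hpe₁, hpe₂, hθ₁, hθ₂⟩ :=
    hJ.exists_iso_image_sum_shift_image e₁ he₁ e₂ he₂ σ τ hσ hτ hστ hτσ
  obtain ⟨d, h₁, h₂, hh⟩ := hJ.exists_glue θ.hom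
  have hh' : resMap hle₂ h₂.inv = θ.inv ≫ resMap hle₁ h₁.inv := by
    rw [← cancel_epi (resMap hle₂ h₂.hom), ← resMap_comp, h₂.hom_inv_id, ← hh, assoc,
      θ.hom_inv_id_assoc, ← resMap_comp, h₁.hom_inv_id, resMap_id, resMap_id]
  -- the glued object `d` is too large: it restricts to the sums of the formal images and of their
  -- suspensions, and the projections to the formal images lift to an idempotent of `d`
  obtain ⟨E, hE, hE₁, hE₂⟩ := hJ.exists_idempotent_lift
    (h₁.hom ≫ p₁ ≫ i₁ ≫ h₁.inv)
    (by simp only [assoc, h₁.inv_hom_id_assoc, reassoc_of% hip₁, reassoc_of% hpe₁])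
    (h₂.hom ≫ p₂ ≫ i₂ ≫ h₂.inv)
    (by simp only [assoc, h₂.inv_hom_id_assoc, reassoc_of% hip₂, reassoc_of% hpe₂]) (by
      simp only [resMap_comp, hh', ← hh, assoc, reassoc_of% hθ₂, ← reassoc_of% hθ₁,
        θ.hom_inv_id_assoc])
  obtain ⟨a, s, r, hsr, hrs⟩ := IsIdempotentComplete.idempotents_split d E hE
  have hsE : s ≫ E = s := by rw [← hrs, reassoc_of% hsr]
  have key (P : ObjectProperty C) [P.IsTriangulated] {x y : C} (h : P.trW.Q.obj d ≅ P.trW.Q.obj y)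
      (i : P.trW.Q.obj x ⟶ P.trW.Q.obj y) (p : P.trW.Q.obj y ⟶ P.trW.Q.obj x)
      (e : P.trW.Q.obj x ⟶ P.trW.Q.obj x) (hip : i ≫ p = e) (hpe : p ≫ e = p)
      (hE : P.trW.Q.map E = h.hom ≫ p ≫ i ≫ h.inv) :
      (P.trW.Q.map s ≫ h.hom ≫ p) ≫ i ≫ h.inv ≫ P.trW.Q.map r = 𝟙 _ ∧
      (i ≫ h.inv ≫ P.trW.Q.map r) ≫ P.trW.Q.map s ≫ h.hom ≫ p = e := by
    constructor
    · have : P.trW.Q.map s ≫ P.trW.Q.map E ≫ P.trW.Q.map r = 𝟙 _ := by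
        rw [← Functor.map_comp, ← Functor.map_comp, reassoc_of% hsE, hsr,
          CategoryTheory.Functor.map_id]
      simpa only [hE, assoc] using this
    · simp only [assoc]
      rw [← assoc (P.trW.Q.map r), ← Functor.map_comp, hrs, hE]
      simp only [assoc, h.inv_hom_id_assoc, hip, hpe]
  obtain ⟨k₁, k₁'⟩ := key J₁ h₁ i₁ p₁ e₁ hip₁ hpe₁ hE₁
  obtain ⟨k₂, k₂'⟩ := key J₂ h₂ i₂ p₂ e₂ hip₂ hpe₂ hE₂
  refine ⟨a, _, _, _, _, k₁, k₁', k₂, k₂', ?_⟩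
  simp only [resMap_comp, resMap_map, assoc, ← hh, hθ₂]

end IsOrthogonalSum

end

/-! ### Sums of orthogonal thick subcategories -/

section

variable {C : Type u} [Category.{v} C] [HasZeroObject C] [HasShift C ℤ] [Preadditive C]
  [∀ n : ℤ, (shiftFunctor C n).Additive] [Pretriangulated C] {J₁ J₂ : ObjectProperty C}

open ObjectProperty (extensionProduct)

lemma isTriangulated_extensionProduct [IsTriangulated C] [J₁.IsTriangulated] [J₂.IsTriangulated]
    [J₁.IsClosedUnderIsomorphisms] [J₂.IsClosedUnderIsomorphisms]
    (h : J₂ ≤ J₁.rightOrthogonal) : (extensionProduct J₁ J₂).IsTriangulated where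
  exists_zero := by
    obtain ⟨z, hz, h₁⟩ := J₁.exists_prop_of_containsZero
    exact ⟨z, hz, ObjectProperty.le_extensionProduct_left (Q := J₂) _ h₁⟩
  toIsTriangulatedClosed₂ := .mk' fun T hT h₁ h₃ => by
    have key : extensionProduct (extensionProduct J₁ J₂) (extensionProduct J₁ J₂) ≤
        extensionProduct J₁ J₂ := calc
      _ = extensionProduct J₁ (extensionProduct (extensionProduct J₂ J₁) J₂) := by
        simp only [ObjectProperty.extensionProduct_assoc]
      _ ≤ extensionProduct J₁ (extensionProduct (extensionProduct J₁ J₂) J₂) :=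
        ObjectProperty.monotone_extensionProduct_right _
          (ObjectProperty.monotone_extensionProduct_left _ (extensionProduct_le_swap h))
      _ = extensionProduct (extensionProduct J₁ J₁) (extensionProduct J₂ J₂) := by
        simp only [ObjectProperty.extensionProduct_assoc]
      _ ≤ extensionProduct J₁ (extensionProduct J₂ J₂) :=
        ObjectProperty.monotone_extensionProduct_left _
          (ObjectProperty.extensionProduct_le_of_isTriangulatedClosed₂ le_rfl le_rfl)
      _ ≤ extensionProduct J₁ J₂ :=
        ObjectProperty.monotone_extensionProduct_right _
          (ObjectProperty.extensionProduct_le_of_isTriangulatedClosed₂ le_rfl le_rfl)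
    exact key _ ⟨_, _, _, _, _, hT, h₁, h₃⟩

/-- In an idempotent complete category, a direct summand of a direct sum of two orthogonal objects
is the direct sum of direct summands of these objects. -/
lemma isStableUnderRetracts_extensionProduct [IsIdempotentComplete C]
    [J₁.IsTriangulated] [J₂.IsTriangulated] [J₁.IsStableUnderRetracts] [J₂.IsStableUnderRetracts]
    (h₁ : J₁ ≤ J₂.rightOrthogonal) (h₂ : J₂ ≤ J₁.rightOrthogonal) :
    (extensionProduct J₁ J₂).IsStableUnderRetracts where
  of_retract {x n} ρ hn := by
    have hJ : IsOrthogonalSum J₁ J₂ (extensionProduct J₁ J₂) :=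
      ⟨ObjectProperty.le_extensionProduct_left _, ObjectProperty.le_extensionProduct_right _,
        h₁, h₂, le_rfl⟩
    obtain ⟨z₁, z₂, hz₁, hz₂, p₁, i₁, p₂, i₂, hid⟩ := hJ.exists_add_eq_id hn
    have h₁₂ : i₁ ≫ ρ.r ≫ ρ.i ≫ p₂ = 0 := h₂ _ hz₂ _ hz₁
    have h₂₁ : i₂ ≫ ρ.r ≫ ρ.i ≫ p₁ = 0 := h₁ _ hz₁ _ hz₂
    have hsum : ρ.i ≫ p₁ ≫ i₁ ≫ ρ.r + ρ.i ≫ p₂ ≫ i₂ ≫ ρ.r = 𝟙 x := by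
      rw [← ρ.retract, ← Preadditive.comp_add, ← assoc p₁, ← assoc p₂, ← Preadditive.add_comp,
        hid, id_comp]
    obtain ⟨f₁, hf₁⟩ : ∃ f, f = ρ.i ≫ p₁ ≫ i₁ ≫ ρ.r := ⟨_, rfl⟩
    obtain ⟨f₂, hf₂⟩ : ∃ f, f = ρ.i ≫ p₂ ≫ i₂ ≫ ρ.r := ⟨_, rfl⟩
    rw [← hf₁, ← hf₂] at hsum
    have h₁₂' : f₁ ≫ f₂ = 0 := by
      simp only [hf₁, hf₂, assoc, reassoc_of% h₁₂, zero_comp, comp_zero]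
    have h₂₁' : f₂ ≫ f₁ = 0 := by
      simp only [hf₁, hf₂, assoc, reassoc_of% h₂₁, zero_comp, comp_zero]
    have hf₁₁ : f₁ ≫ f₁ = f₁ := by
      rw [← add_zero (f₁ ≫ f₁), ← h₁₂', ← Preadditive.comp_add, hsum, comp_id]
    have hf₂₂ : f₂ ≫ f₂ = f₂ := by
      rw [← zero_add (f₂ ≫ f₂), ← h₂₁', ← Preadditive.comp_add, hsum, comp_id]
    obtain ⟨x₁, s₁, r₁, hsr₁, hrs₁⟩ := IsIdempotentComplete.idempotents_split x f₁ hf₁₁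
    obtain ⟨x₂, s₂, r₂, hsr₂, hrs₂⟩ := IsIdempotentComplete.idempotents_split x f₂ hf₂₂
    have hx₁ : J₁ x₁ := J₁.prop_of_retract
      ⟨s₁ ≫ ρ.i ≫ p₁, i₁ ≫ ρ.r ≫ r₁, by
        have : s₁ ≫ f₁ ≫ r₁ = 𝟙 _ := by rw [← hrs₁, assoc, hsr₁, comp_id, hsr₁]
        simpa only [hf₁, assoc] using this⟩ hz₁
    have hx₂ : J₂ x₂ := J₂.prop_of_retract
      ⟨s₂ ≫ ρ.i ≫ p₂, i₂ ≫ ρ.r ≫ r₂, by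
        have : s₂ ≫ f₂ ≫ r₂ = 𝟙 _ := by rw [← hrs₂, assoc, hsr₂, comp_id, hsr₂]
        simpa only [hf₂, assoc] using this⟩ hz₂
    have hsr₁₂ : s₁ ≫ r₂ = 0 := h₂ _ hx₂ _ hx₁
    have hsr₂₁ : s₂ ≫ r₁ = 0 := h₁ _ hx₁ _ hx₂
    let e : x₁ ⊞ x₂ ≅ x :=
      { hom := biprod.desc s₁ s₂
        inv := biprod.lift r₁ r₂
        hom_inv_id := by ext <;> simp [hsr₁, hsr₂, hsr₁₂, hsr₂₁]
        inv_hom_id := by rw [biprod.lift_desc, hrs₁, hrs₂, hsum] }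
    exact ObjectProperty.prop_of_iso _ e
      ⟨_, _, _, _, _, binaryBiproductTriangle_distinguished x₁ x₂, hx₁, hx₂⟩

end

/-! ### Tensor ideals and supports -/

section

variable {K : Type u} [Category.{v} K] [HasZeroObject K] [HasShift K ℤ] [Preadditive K]
  [∀ n : ℤ, (shiftFunctor K n).Additive] [Pretriangulated K] [MonoidalCategory K]

lemma IsThickTensorIdeal.isStableUnderRetracts {J : ObjectProperty K}
    (hJ : IsThickTensorIdeal J) : J.IsStableUnderRetracts where
  of_retract {x y} ρ hy := by
    have := hJ.closedUnderIso
    obtain ⟨z, g, k, hT⟩ := distinguished_cocone_triangle ρ.i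
    have : Mono ρ.i := mono_of_mono_fac ρ.retract
    obtain ⟨e, -⟩ := exists_iso_binaryBiproduct_of_distTriang _ hT
      (Triangle.mor₃_eq_zero_of_mono₁ _ hT this)
    exact (hJ.thick x z (J.prop_of_iso e hy)).1

lemma isThickTensorIdeal_of_isStableUnderRetracts (J : ObjectProperty K) [J.IsTriangulated]
    [J.IsStableUnderRetracts] (h : ∀ a b, J a → J (a ⊗ b)) : IsThickTensorIdeal J where
  isTriangulated := inferInstance
  closedUnderIso := inferInstance
  thick _ _ h := ⟨ObjectProperty.IsStableUnderRetracts.of_biprod_left (P := J) h,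
    ObjectProperty.IsStableUnderRetracts.of_biprod_right (P := J) h⟩
  ideal := h

lemma IsThickTensorIdeal.tensor_left [BraidedCategory K] {J : ObjectProperty K}
    (hJ : IsThickTensorIdeal J) (a : K) {b : K} (hb : J b) : J (a ⊗ b) :=
  have := hJ.closedUnderIso
  J.prop_of_iso (β_ b a) (hJ.ideal b a hb)

lemma IsThickTensorIdeal.biprod {J : ObjectProperty K} (hJ : IsThickTensorIdeal J) {a b : K}
    (ha : J a) (hb : J b) : J (a ⊞ b) :=
  have := hJ.closedUnderIso
  have := hJ.isTriangulated
  J.ext_of_isTriangulatedClosed₂ _ (binaryBiproductTriangle_distinguished a b) ha hb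

lemma isThickTensorIdeal_isZero [TensorTriangulated K] :
    IsThickTensorIdeal (fun a : K => IsZero a) := by
  let J : ObjectProperty K := fun a => IsZero a
  have : J.IsStableUnderRetracts :=
    ⟨fun ρ h => (IsZero.iff_id_eq_zero _).2 (by
      rw [← ρ.retract, h.eq_of_tgt ρ.i 0, zero_comp])⟩
  have : J.IsTriangulated :=
    { exists_zero := ⟨_, isZero_zero K, isZero_zero K⟩
      isStableUnderShiftBy := fun n => ⟨fun a ha => (shiftFunctor K n).map_isZero ha⟩
      toIsTriangulatedClosed₂ := .mk' fun T hT h₁ h₃ => Triangle.isZero₂_of_isZero₁₃ _ hT h₁ h₃ }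
  exact isThickTensorIdeal_of_isStableUnderRetracts J
    fun a b ha => ((curriedTensor K).flip.obj b).map_isZero ha

/-- The objects whose product with `y` belongs to a thick tensor ideal form a thick tensor
ideal. -/
lemma IsThickTensorIdeal.quotient [TensorTriangulated K] {J : ObjectProperty K}
    (hJ : IsThickTensorIdeal J) (y : K) : IsThickTensorIdeal (fun c => J (y ⊗ c)) := by
  have := hJ.closedUnderIso
  have := hJ.isTriangulated
  have := hJ.isStableUnderRetracts
  have h₁ : (J.inverseImage ((curriedTensor K).obj y)).IsTriangulated := inferInstance
  have h₂ : (J.inverseImage ((curriedTensor K).obj y)).IsStableUnderRetracts :=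
    ⟨fun ρ h => J.prop_of_retract (ρ.map ((curriedTensor K).obj y)) h⟩
  exact isThickTensorIdeal_of_isStableUnderRetracts (J.inverseImage ((curriedTensor K).obj y))
    fun a b ha => J.prop_of_iso (α_ y a b) (hJ.ideal _ b ha)

/-- An object `a` is a direct summand of `(a ⊗ D a) ⊗ a`. -/
lemma exists_section_ev [MonoidalClosed K] [StronglyClosed K] (a : K) :
    ∃ s : a ⟶ (a ⊗ dualObj a) ⊗ a,
      s ≫ (ihom.ev a).app (𝟙_ K) ▷ a ≫ (λ_ a).hom = 𝟙 a := by
  have := StronglyClosed.strongly_dualizable a a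
  refine ⟨(ρ_ a).inv ≫ a ◁ (MonoidalClosed.curry (ρ_ a).hom ≫ inv (dualTensorHom a a)) ≫
    (α_ _ _ _).inv, ?_⟩
  have h : MonoidalClosed.uncurry (dualTensorHom a a) =
      (α_ a (dualObj a) a).inv ≫ (ihom.ev a).app (𝟙_ K) ▷ a ≫ (λ_ a).hom :=
    MonoidalClosed.uncurry_curry _
  simp only [assoc]
  rw [← h, ← MonoidalClosed.uncurry_natural_left, assoc, IsIso.inv_hom_id, comp_id,
    MonoidalClosed.uncurry_curry, Iso.inv_hom_id]

lemma supp_biprod (a b : K) : supp (a ⊞ b) = supp a ∪ supp b := by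
  ext P
  simp only [supp, Set.mem_union, Set.mem_ofPred_eq, ← not_and_or, not_iff_not]
  exact ⟨P.isThickTensorIdeal.thick a b,
    fun h => P.isThickTensorIdeal.biprod h.1 h.2⟩

lemma supp_tensor [BraidedCategory K] (a b : K) : supp (a ⊗ b) = supp a ∩ supp b := by
  ext P
  simp only [supp, Set.mem_inter_iff, Set.mem_ofPred_eq, ← not_or, not_iff_not]
  exact ⟨P.prime a b, fun h => h.elim (P.isThickTensorIdeal.ideal a b)
    (P.isThickTensorIdeal.tensor_left a)⟩

lemma supp_unit : supp (𝟙_ K) = Set.univ := by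
  refine Set.eq_univ_of_forall fun P h => ?_
  obtain ⟨a, ha⟩ := P.proper
  have := P.isThickTensorIdeal.closedUnderIso
  exact ha (P.carrier.prop_of_iso (λ_ a) (P.isThickTensorIdeal.ideal _ a h))

open ZeroObject in
lemma supp_zero : supp (0 : K) = ∅ := by
  refine Set.eq_empty_of_forall_notMem fun P h => h ?_
  have := P.isThickTensorIdeal.closedUnderIso
  have := P.isThickTensorIdeal.isTriangulated
  exact P.carrier.prop_zero

open ZeroObject in
lemma isTopologicalBasis_compl_supp :
    TopologicalSpace.IsTopologicalBasis (Set.range fun a : K => (supp a)ᶜ) where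
  exists_subset_inter := by
    rintro _ ⟨a, rfl⟩ _ ⟨b, rfl⟩ P hP
    refine ⟨_, ⟨a ⊞ b, rfl⟩, ?_⟩
    dsimp only
    rw [supp_biprod, Set.compl_union]
    exact ⟨hP, le_rfl⟩
  sUnion_eq := Set.eq_univ_of_univ_subset
    (Set.subset_sUnion_of_mem ⟨0, by simp only [supp_zero, Set.compl_empty]⟩)
  eq_generateFrom := rfl

/-- The complement of a quasi-compact open subset is the support of an object. -/
lemma exists_supp_eq_compl [BraidedCategory K] {U : Set (Spc K)} (hU : IsOpen U)
    (hcU : IsCompact U) : ∃ z : K, supp z = Uᶜ := by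
  obtain ⟨s, hs, rfl⟩ := eq_finite_iUnion_of_isTopologicalBasis_of_isCompact_open
    (fun a : K => (supp a)ᶜ) isTopologicalBasis_compl_supp U hcU hU
  clear hU hcU
  induction s, hs using Set.Finite.induction_on with
  | empty => exact ⟨𝟙_ K, by simp [supp_unit]⟩
  | @insert a s _ _ ih =>
    obtain ⟨z, hz⟩ := ih
    refine ⟨a ⊗ z, ?_⟩
    rw [supp_tensor, hz, Set.biUnion_insert, Set.compl_union, compl_compl]

lemma isThickTensorIdeal_supportedOn (Y : Set (Spc K)) :
    IsThickTensorIdeal (supportedOn (K := K) Y) := by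
  have h (a : K) : supportedOn Y a ↔ ∀ P : Spc K, P ∉ Y → P.carrier a :=
    forall_congr' fun P => not_imp_comm
  have hret : (supportedOn (K := K) Y).IsStableUnderRetracts := ⟨fun ρ ha => by
    rw [h] at ha ⊢
    intro P hP
    have := P.isThickTensorIdeal.isStableUnderRetracts
    exact P.carrier.prop_of_retract ρ (ha P hP)⟩
  have htri : (supportedOn (K := K) Y).IsTriangulated :=
    { exists_zero := ⟨_, isZero_zero K, by
        rw [supportedOn, supp_zero]
        exact Set.empty_subset _⟩
      isStableUnderShiftBy := fun n => ⟨fun a ha => by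
        rw [h] at ha
        refine (h _).2 fun P hP => ?_
        have := P.isThickTensorIdeal.isTriangulated
        exact P.carrier.le_shift n _ (ha P hP)⟩
      toIsTriangulatedClosed₂ := .mk' fun T hT h₁ h₃ => by
        rw [h] at h₁ h₃ ⊢
        intro P hP
        have := P.isThickTensorIdeal.isTriangulated
        have := P.isThickTensorIdeal.closedUnderIso
        exact P.carrier.ext_of_isTriangulatedClosed₂ _ hT (h₁ P hP) (h₃ P hP) }
  refine isThickTensorIdeal_of_isStableUnderRetracts _ fun a b ha => ?_
  rw [h] at ha ⊢
  exact fun P hP => P.isThickTensorIdeal.ideal a b (ha P hP)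

instance (Y : Set (Spc K)) : (supportedOn (K := K) Y).IsTriangulated :=
  (isThickTensorIdeal_supportedOn Y).isTriangulated

instance (Y : Set (Spc K)) : (supportedOn (K := K) Y).IsStableUnderRetracts :=
  (isThickTensorIdeal_supportedOn Y).isStableUnderRetracts

variable [SymmetricCategory K] [MonoidalClosed K] [StronglyClosed K]

/-- As every object is a direct summand of `(a ⊗ D a) ⊗ a`, thick tensor ideals are radical. -/
lemma IsThickTensorIdeal.of_tensor_self {J : ObjectProperty K} (hJ : IsThickTensorIdeal J)
    {a : K} (ha : J (a ⊗ a)) : J a := by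
  have := hJ.closedUnderIso
  have := hJ.isStableUnderRetracts
  obtain ⟨s, hs⟩ := exists_section_ev a
  refine J.prop_of_retract ⟨s, _, hs⟩ ?_
  exact J.prop_of_iso ((α_ _ _ _).symm ≪≫ whiskerRightIso (β_ _ _) a)
    (hJ.tensor_left (dualObj a) ha)

variable [TensorTriangulated K]

/-- A thick tensor ideal is the intersection of the primes which contain it. -/
theorem exists_prime {J : ObjectProperty K} (hJ : IsThickTensorIdeal J) {a : K} (ha : ¬ J a) :
    ∃ P : Spc K, J ≤ P.carrier ∧ ¬ P.carrier a := by
  obtain ⟨P, hJP, hP⟩ := zorn_le_nonempty₀ {P : ObjectProperty K | IsThickTensorIdeal P ∧ ¬ P a}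
    (fun c hc hchain Q hQ => by
      refine ⟨fun x => ∃ P ∈ c, P x, ⟨?_, ?_⟩, fun P hP x hx => ⟨P, hP, hx⟩⟩
      · have hne : IsThickTensorIdeal Q := (hc hQ).1
        have hQ₁ := hne.isTriangulated
        let S : ObjectProperty K := fun x => ∃ P ∈ c, P x
        have hret : S.IsStableUnderRetracts := ⟨fun ρ ⟨P, hP, h⟩ => by
          have := (hc hP).1.isStableUnderRetracts
          exact ⟨P, hP, P.prop_of_retract ρ h⟩⟩
        have htri : S.IsTriangulated :=
          { exists_zero := by
              obtain ⟨z, hz, h⟩ := Q.exists_prop_of_containsZero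
              exact ⟨z, hz, Q, hQ, h⟩
            isStableUnderShiftBy := fun n => ⟨fun x ⟨P, hP, h⟩ => by
              have := (hc hP).1.isTriangulated
              exact ⟨P, hP, P.le_shift n _ h⟩⟩
            toIsTriangulatedClosed₂ := .mk' fun T hT ⟨P₁, hP₁, h₁⟩ ⟨P₃, hP₃, h₃⟩ => by
              rcases hchain.total hP₁ hP₃ with h | h
              · have := (hc hP₃).1.isTriangulated
                have := (hc hP₃).1.closedUnderIso
                exact ⟨P₃, hP₃, P₃.ext_of_isTriangulatedClosed₂ _ hT (h _ h₁) h₃⟩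
              · have := (hc hP₁).1.isTriangulated
                have := (hc hP₁).1.closedUnderIso
                exact ⟨P₁, hP₁, P₁.ext_of_isTriangulatedClosed₂ _ hT h₁ (h _ h₃)⟩ }
        exact isThickTensorIdeal_of_isStableUnderRetracts S
          fun a b ⟨P, hP, h⟩ => ⟨P, hP, (hc hP).1.ideal a b h⟩
      · rintro ⟨P, hP, h⟩
        exact (hc hP).2 h) J ⟨hJ, ha⟩
  have hP₁ : IsThickTensorIdeal P := hP.1.1
  have hmax {Q : ObjectProperty K} (hQ : IsThickTensorIdeal Q) (hPQ : P ≤ Q) {x : K} (hx : Q x)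
      (hxP : ¬ P x) : Q a := by
    by_contra hQa
    exact hxP (hP.2 ⟨hQ, hQa⟩ hPQ x hx)
  refine ⟨⟨P, hP₁, ⟨a, hP.1.2⟩, fun x y hxy => ?_⟩, hJP, hP.1.2⟩
  by_contra! h
  have := hP₁.closedUnderIso
  -- if `x` and `y` are not in `P`, then maximality gives `y ⊗ a ∈ P`, and then `a ⊗ a ∈ P`
  have hya : P (y ⊗ a) := hmax (hP₁.quotient y) (fun c hc => hP₁.tensor_left y hc)
    (P.prop_of_iso (β_ x y) hxy) h.1
  have haa : P (a ⊗ a) := hmax (hP₁.quotient a) (fun c hc => hP₁.tensor_left a hc)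
    (P.prop_of_iso (β_ y a) hya) h.2
  exact hP.1.2 (hP₁.of_tensor_self haa)

lemma isZero_of_supp_eq_empty {a : K} (ha : supp a = ∅) : IsZero a := by
  by_contra h
  obtain ⟨P, -, hP⟩ := exists_prime isThickTensorIdeal_isZero h
  exact (ha ▸ hP : P ∈ (∅ : Set (Spc K)))

/-- There are no nonzero morphisms between objects with disjoint supports. -/
theorem hom_eq_zero_of_disjoint_supp {a b : K} (h : Disjoint (supp a) (supp b)) (f : a ⟶ b) :
    f = 0 := by
  have hab : IsZero (a ⊗ b) :=
    isZero_of_supp_eq_empty (by rw [supp_tensor, h.inter_eq])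
  have hz : IsZero ((a ⊗ dualObj a) ⊗ b) :=
    (isThickTensorIdeal_isZero.tensor_left (dualObj a) hab).of_iso
      (whiskerRightIso (β_ _ _) b ≪≫ α_ _ _ _)
  obtain ⟨s, hs⟩ := exists_section_ev a
  -- `f` factors through `(a ⊗ D a) ⊗ b`
  have hf : f = (s ≫ (a ⊗ dualObj a) ◁ f) ≫ (ihom.ev a).app (𝟙_ K) ▷ b ≫ (λ_ b).hom := by
    rw [assoc, whisker_exchange_assoc]
    change f = s ≫ (ihom.ev a).app (𝟙_ K) ▷ a ≫ 𝟙_ K ◁ f ≫ (λ_ b).hom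
    rw [leftUnitor_naturality, reassoc_of% hs]
  rw [hf, hz.eq_of_tgt (s ≫ _) 0, zero_comp]

open ObjectProperty (extensionProduct) in
/-- If `U₁` and `U₂` cover the spectrum, then every object supported outside of `U₁ ∩ U₂` is the
direct sum of an object supported outside of `U₁` and of an object supported outside of `U₂`. -/
theorem isOrthogonalSum_supportedOn [IsTriangulated K] [IsIdempotentComplete K]
    {U₁ U₂ : Set (Spc K)} (hU₁ : IsOpen U₁) (hU₂ : IsOpen U₂) (hcU₁ : IsCompact U₁)
    (hcU₂ : IsCompact U₂) (hcover : U₁ ∪ U₂ = Set.univ) :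
    IsOrthogonalSum (supportedOn (K := K) U₁ᶜ) (supportedOn U₂ᶜ) (supportedOn (U₁ ∩ U₂)ᶜ) := by
  have hd : Disjoint U₁ᶜ U₂ᶜ := by
    rw [Set.disjoint_compl_left_iff_subset, Set.compl_subset_iff_union, Set.union_comm, hcover]
  have h₁ : supportedOn (K := K) U₁ᶜ ≤ (supportedOn U₂ᶜ).rightOrthogonal :=
    fun b hb a f ha => hom_eq_zero_of_disjoint_supp (hd.symm.mono ha hb) f
  have h₂ : supportedOn (K := K) U₂ᶜ ≤ (supportedOn U₁ᶜ).rightOrthogonal :=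
    fun b hb a f ha => hom_eq_zero_of_disjoint_supp (hd.mono ha hb) f
  refine ⟨fun a ha => ha.trans (Set.compl_subset_compl.2 Set.inter_subset_left),
    fun a ha => ha.trans (Set.compl_subset_compl.2 Set.inter_subset_right), h₁, h₂, ?_⟩
  have := isTriangulated_extensionProduct h₂
  have := isStableUnderRetracts_extensionProduct h₁ h₂
  have hJ : IsThickTensorIdeal (extensionProduct (supportedOn (K := K) U₁ᶜ) (supportedOn U₂ᶜ)) :=
    isThickTensorIdeal_of_isStableUnderRetracts _ (by
      rintro a b ⟨z₁, z₂, f, g, k, hT, hz₁, hz₂⟩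
      exact ⟨_, _, _, _, _, ((curriedTensor K).flip.obj b).map_distinguished _ hT,
        (isThickTensorIdeal_supportedOn _).ideal _ b hz₁,
        (isThickTensorIdeal_supportedOn _).ideal _ b hz₂⟩)
  intro a ha
  by_contra h
  -- a prime which contains both subcategories, but not `a`
  obtain ⟨P, hJP, hP⟩ := exists_prime hJ h
  obtain ⟨z₁, hz₁⟩ := exists_supp_eq_compl hU₁ hcU₁
  obtain ⟨z₂, hz₂⟩ := exists_supp_eq_compl hU₂ hcU₂
  have hP₁ : P ∉ U₁ᶜ := fun h => (hz₁ ▸ h : P ∈ supp z₁)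
    (hJP _ (ObjectProperty.le_extensionProduct_left (Q := supportedOn U₂ᶜ) _ hz₁.le))
  have hP₂ : P ∉ U₂ᶜ := fun h => (hz₂ ▸ h : P ∈ supp z₂)
    (hJP _ (ObjectProperty.le_extensionProduct_right (P := supportedOn U₁ᶜ) _ hz₂.le))
  exact ha hP ⟨not_not.1 hP₁, not_not.1 hP₂⟩

end

/-! ### Gluing in idempotent completions -/

section

variable {K : Type u} [Category.{v} K] [HasZeroObject K] [HasShift K ℤ] [Preadditive K]
  [∀ n : ℤ, (shiftFunctor K n).Additive] [Pretriangulated K] [IsTriangulated K]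
  [MonoidalCategory K]

/-- The isomorphism in the idempotent completion `K(U)` given by a splitting `(f, g)` of the
idempotent `e` in the Verdier quotient. -/
noncomputable def karoubiIso {U : Set (Spc K)} {a x : K}
    {e : (isosOn U).Q.obj x ⟶ (isosOn U).Q.obj x} (he : e ≫ e = e)
    (f : (isosOn U).Q.obj a ⟶ (isosOn U).Q.obj x) (g : (isosOn U).Q.obj x ⟶ (isosOn U).Q.obj a)
    (hfg : f ≫ g = 𝟙 _) (hgf : g ≫ f = e) :
    (restr U).obj a ≅ (⟨(isosOn U).Q.obj x, e, he⟩ : KOn U) where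
  hom := ⟨f, by
    have hfe : f ≫ e = f := by rw [← hgf, reassoc_of% hfg]
    exact (id_comp _).trans hfe⟩
  inv := ⟨g, by
    change e ≫ g ≫ 𝟙 _ = g
    rw [comp_id, ← hgf, assoc, hfg, comp_id]⟩
  hom_inv_id := Idempotents.Karoubi.Hom.ext hfg
  inv_hom_id := Idempotents.Karoubi.Hom.ext hgf

variable {U₁ U₂ : Set (Spc K)}

theorem nonempty_gluing [IsIdempotentComplete K]
    (hJ : IsOrthogonalSum (supportedOn (K := K) U₁ᶜ) (supportedOn U₂ᶜ) (supportedOn (U₁ ∩ U₂)ᶜ))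
    (a₁ : KOn U₁) (a₂ : KOn U₂)
    (σ : (restrK (Set.inter_subset_left : U₁ ∩ U₂ ⊆ U₁)).obj a₁ ≅
      (restrK (Set.inter_subset_right : U₁ ∩ U₂ ⊆ U₂)).obj a₂) :
    Nonempty (Gluing a₁ a₂ σ) := by
  obtain ⟨X₁, e₁, he₁⟩ := a₁
  obtain ⟨X₂, e₂, he₂⟩ := a₂
  obtain ⟨x₁, rfl⟩ : ∃ x, (isosOn U₁).Q.obj x = X₁ :=
    ⟨_, (Localization.Construction.objEquiv (isosOn U₁)).apply_symm_apply X₁⟩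
  obtain ⟨x₂, rfl⟩ : ∃ x, (isosOn U₂).Q.obj x = X₂ :=
    ⟨_, (Localization.Construction.objEquiv (isosOn U₂)).apply_symm_apply X₂⟩
  obtain ⟨a, f₁, g₁, f₂, g₂, hfg₁, hgf₁, hfg₂, hgf₂, h⟩ :=
    hJ.exists_glue_of_idempotent e₁ he₁ e₂ he₂ σ.hom.f σ.inv.f
      (Idempotents.Karoubi.comp_p σ.hom) (Idempotents.Karoubi.comp_p σ.inv)
      (congrArg Idempotents.Karoubi.Hom.f σ.hom_inv_id)
      (congrArg Idempotents.Karoubi.Hom.f σ.inv_hom_id)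
  exact ⟨⟨a, karoubiIso he₁ f₁ g₁ hfg₁ hgf₁, karoubiIso he₂ f₂ g₂ hfg₂ hgf₂,
    Idempotents.Karoubi.Hom.ext
      ((id_comp _).trans (h.trans
        (id_comp (resMap (ObjectProperty.trW_monotone hJ.le₂) f₂)).symm))⟩⟩

theorem nonempty_gluingIso
    (hJ : IsOrthogonalSum (supportedOn (K := K) U₁ᶜ) (supportedOn U₂ᶜ) (supportedOn (U₁ ∩ U₂)ᶜ))
    {a₁ : KOn U₁} {a₂ : KOn U₂}
    {σ : (restrK (Set.inter_subset_left : U₁ ∩ U₂ ⊆ U₁)).obj a₁ ≅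
      (restrK (Set.inter_subset_right : U₁ ∩ U₂ ⊆ U₂)).obj a₂}
    (g g' : Gluing a₁ a₂ σ) : Nonempty (GluingIso g g') := by
  let φ₁ := g.iso₁ ≪≫ g'.iso₁.symm
  let φ₂ := g.iso₂ ≪≫ g'.iso₂.symm
  -- the isomorphisms `φ₁` and `φ₂` agree over `U₁ ∩ U₂`, hence they lift to a morphism of `K`
  have hφ : (restrCompIso Set.inter_subset_left).inv.app g.obj ≫
      (restrK (Set.inter_subset_left : U₁ ∩ U₂ ⊆ U₁)).map φ₁.hom ≫
        (restrCompIso Set.inter_subset_left).hom.app g'.obj =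
      (restrCompIso Set.inter_subset_right).inv.app g.obj ≫
        (restrK (Set.inter_subset_right : U₁ ∩ U₂ ⊆ U₂)).map φ₂.hom ≫
          (restrCompIso Set.inter_subset_right).hom.app g'.obj := by
    let A := (restrCompIso Set.inter_subset_left).symm.app g.obj ≪≫
      (restrK (Set.inter_subset_left : U₁ ∩ U₂ ⊆ U₁)).mapIso g.iso₁
    let A' := (restrCompIso Set.inter_subset_left).symm.app g'.obj ≪≫
      (restrK (Set.inter_subset_left : U₁ ∩ U₂ ⊆ U₁)).mapIso g'.iso₁
    let B := (restrCompIso Set.inter_subset_right).symm.app g.obj ≪≫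
      (restrK (Set.inter_subset_right : U₁ ∩ U₂ ⊆ U₂)).mapIso g.iso₂
    let B' := (restrCompIso Set.inter_subset_right).symm.app g'.obj ≪≫
      (restrK (Set.inter_subset_right : U₁ ∩ U₂ ⊆ U₂)).mapIso g'.iso₂
    have hAB : A ≪≫ σ = B := Iso.ext ((assoc _ _ _).trans g.comm)
    have hAB' : A' ≪≫ σ = B' := Iso.ext ((assoc _ _ _).trans g'.comm)
    have h : A.hom ≫ A'.inv = B.hom ≫ B'.inv := by
      rw [← hAB, ← hAB', Iso.trans_hom A σ, Iso.trans_inv A' σ, assoc, σ.hom_inv_id_assoc]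
    rw [Iso.trans_hom, Iso.trans_hom, Functor.map_comp, Functor.map_comp, assoc, assoc,
      ← assoc ((restrCompIso _).inv.app g.obj), ← assoc ((restrCompIso _).inv.app g.obj)]
    exact h
  obtain ⟨f, hf₁, hf₂⟩ := hJ.exists_lift (x := g.obj) (y := g'.obj) φ₁.hom.f φ₂.hom.f
    (((id_comp _).trans (comp_id _)).symm.trans
      ((congrArg Idempotents.Karoubi.Hom.f hφ).trans ((id_comp _).trans (comp_id _))))
  have hf₁' : (restr U₁).map f = φ₁.hom := Idempotents.Karoubi.Hom.ext hf₁
  have hf₂' : (restr U₂).map f = φ₂.hom := Idempotents.Karoubi.Hom.ext hf₂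
  have : IsIso f := hJ.isIso_of_isIso_Q_map f
    ⟨φ₁.inv.f, by rw [hf₁]; exact congrArg Idempotents.Karoubi.Hom.f φ₁.hom_inv_id,
      by rw [hf₁]; exact congrArg Idempotents.Karoubi.Hom.f φ₁.inv_hom_id⟩
    ⟨φ₂.inv.f, by rw [hf₂]; exact congrArg Idempotents.Karoubi.Hom.f φ₂.hom_inv_id,
      by rw [hf₂]; exact congrArg Idempotents.Karoubi.Hom.f φ₂.inv_hom_id⟩
  exact ⟨⟨asIso f, by simp [hf₁', φ₁], by simp [hf₂', φ₂]⟩⟩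

end

end TTGeometry

theorem mainTheorem2 (K : Type u) [Category.{v} K] [HasZeroObject K] [HasShift K ℤ]
    [Preadditive K] [∀ n : ℤ, (shiftFunctor K n).Additive] [Pretriangulated K]
    [IsTriangulated K] [MonoidalCategory K] [SymmetricCategory K] [TensorTriangulated K]
    [MonoidalClosed K] [StronglyClosed K] [IsIdempotentComplete K]
    (U₁ U₂ : Set (Spc K)) (hU₁ : IsOpen U₁) (hU₂ : IsOpen U₂)
    (hcU₁ : IsCompact U₁) (hcU₂ : IsCompact U₂) (hcover : U₁ ∪ U₂ = Set.univ)
    (a₁ : KOn U₁) (a₂ : KOn U₂)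
    (σ : (restrK (Set.inter_subset_left : U₁ ∩ U₂ ⊆ U₁)).obj a₁ ≅
      (restrK (Set.inter_subset_right : U₁ ∩ U₂ ⊆ U₂)).obj a₂) :
    Nonempty (Gluing a₁ a₂ σ) ∧
      ∀ g g' : Gluing a₁ a₂ σ, Nonempty (GluingIso g g') := by
  have hJ := isOrthogonalSum_supportedOn hU₁ hU₂ hcU₁ hcU₂ hcover
  exact ⟨nonempty_gluing hJ a₁ a₂ σ, nonempty_gluingIso hJ⟩
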